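/- Let $$\mathcal A=\Bigl\{(\alpha,\beta,\gamma)\in\bigl[0,\tfrac{\pi}{2}\bigr]^3 : \alpha+\beta+\gamma<\pi\Bigr\}.$$ For $(\alpha,\beta,\gamma)\in\mathcal A$ let $S_{\alpha,\beta,\gamma}$ be the triangular surface obtained from two copies of a hyperbolic triangle with interior angles $\alpha,\beta,\gamma$ (unique up to isometry; a vertex of angle $0$ is an ideal point) by gluing them along their corresponding sides, with its length metric; it is a sphere with three singular points, namely cone points of total angles $2\alpha,2\beta,2\gamma$, or a cusp in place of a cone point where the angle is $0$ (cusps are not points of the surface). For $p\in S_{\alpha,\beta,\gamma}$ let $$r_p=\max\{r\ge 0 : B_r(p)\text{ is isometric to an open disk of radius } r \text{ in } \mathbb H^2\}$$ be the injectivity radius at $p$, where $B_r(p)$ is the open ball and carries its intrinsic metric, and let $r(S_{\alpha,\beta,\gamma})=\max_{p} r_p$ be the maximum injectivity radius. Let $(\alpha,\beta,\gamma),(\alpha',\beta',\gamma')\in\mathcal A$ with $\alpha\le\alpha'$, $\beta\le\beta'$ and $\gamma\le\gamma'$. Then $$r(S_{\alpha,\beta,\gamma})\ \ge\ r(S_{\alpha',\beta',\gamma'}),$$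 with equality if and only if $(\alpha,\beta,\gamma)=(\alpha',\beta',\gamma')$. -/

import Mathlib

open Set Topology
open scoped UpperHalfPlane ENNReal NNReal

noncomputable section

/-- A closed half-plane of the hyperbolic plane `ℍ` (upper half-plane model), given by a normalised
defining function `z ↦ a |z|² + b Re z + c` with `b² - 4ac = 1`. The zero set of this function is
a complete geodesic (a vertical half-line or a half-circle orthogonal to the real axis), and every
complete geodesic with a choice of one of its two sides arises from exactly one such triple. -/
structure HypHalfPlane where
  a : ℝ
  b : ℝ
  c : ℝ
  normalized : b ^ 2 - 4 * a * c = 1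

namespace HypHalfPlane

/-- The defining function of the half-plane. -/
def eval (H : HypHalfPlane) (z : ℍ) : ℝ :=
  H.a * (z.re ^ 2 + z.im ^ 2) + H.b * z.re + H.c

/-- The points of the closed half-plane. -/
def carrier (H : HypHalfPlane) : Set ℍ := {z | 0 ≤ H.eval z}

/-- The complete geodesic that bounds the half-plane. -/
def line (H : HypHalfPlane) : Set ℍ := {z | H.eval z = 0}

/-- The inner product of the inward unit normals of two half-planes: at any common point of
the two boundary geodesics it is the Euclidean inner product of the gradients of the two defining
functions, which are Euclidean unit vectors on the respective geodesics. -/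
def normalInner (H K : HypHalfPlane) : ℝ :=
  H.b * K.b - 2 * H.a * K.c - 2 * H.c * K.a

/-- The interior angle of `H ∩ K` between the two boundary geodesics is `θ`: the inward normals
make the angle `π - θ`. For `θ = 0` and `H ∩ K` nonempty this means that the two geodesics are
distinct and asymptotic, with `H ∩ K` the region between them: they meet at an ideal vertex. -/
def MeetAtAngle (H K : HypHalfPlane) (θ : ℝ) : Prop :=
  normalInner H K = -Real.cos θ

theorem continuous_eval (H : HypHalfPlane) : Continuous H.eval := by
  unfold eval
  have h1 : Continuous fun z : ℍ => z.re := UpperHalfPlane.continuous_re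
  have h2 : Continuous fun z : ℍ => z.im := UpperHalfPlane.continuous_im
  fun_prop

theorem exists_eval_neg (H : HypHalfPlane) : ∃ z : ℍ, H.eval z < 0 := by
  obtain ⟨a, b, c, h⟩ := H
  rcases lt_trichotomy a 0 with ha | ha | ha
  · refine ⟨⟨⟨0, 1 + |c| / (-a)⟩, ?_⟩, ?_⟩
    · have : 0 ≤ |c| / (-a) := div_nonneg (abs_nonneg c) (by linarith)
      simp only
      linarith
    · have h0 : 0 ≤ |c| / (-a) := div_nonneg (abs_nonneg c) (by linarith)
      have h1 : a * (|c| / (-a)) = -|c| := by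
        rw [div_neg, mul_neg, mul_div_cancel₀ _ ha.ne]
      change a * ((0 : ℝ) ^ 2 + (1 + |c| / (-a)) ^ 2) + b * 0 + c < 0
      have h2 : a * (|c| / (-a)) ^ 2 ≤ 0 := mul_nonpos_of_nonpos_of_nonneg ha.le (sq_nonneg _)
      nlinarith [le_abs_self c, abs_nonneg c]
  · subst ha
    refine ⟨⟨⟨-b * (c + 1), 1⟩, one_pos⟩, ?_⟩
    change (0 : ℝ) * ((-b * (c + 1)) ^ 2 + 1 ^ 2) + b * (-b * (c + 1)) + c < 0
    have hb : b ^ 2 = 1 := by linarith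
    have e : (0 : ℝ) * ((-b * (c + 1)) ^ 2 + 1 ^ 2) + b * (-b * (c + 1)) + c
      = -(b ^ 2) * (c + 1) + c := by ring
    rw [e, hb]
    linarith
  · refine ⟨⟨⟨-b / (2 * a), 1 / (4 * a)⟩, by simp only; positivity⟩, ?_⟩
    change a * ((-b / (2 * a)) ^ 2 + (1 / (4 * a)) ^ 2) + b * (-b / (2 * a)) + c < 0
    have e : a * ((-b / (2 * a)) ^ 2 + (1 / (4 * a)) ^ 2) + b * (-b / (2 * a)) + c
      = (-4 * (b ^ 2 - 4 * a * c) + 1) / (16 * a) := by field_simp; ring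
    rw [e, h]
    exact div_neg_of_neg_of_pos (by norm_num) (by linarith)

end HypHalfPlane

/-- A hyperbolic triangle with interior angles `α, β, γ` at the vertices `A, B, C`, presented as
the intersection of the three closed half-planes bounded by the lines of the sides `a, b, c`
opposite to `A, B, C`. A vertex with angle `0` is an ideal point (not a point of `ℍ`). -/
structure HypTriangle (α β γ : ℝ) where
  sideA : HypHalfPlane
  sideB : HypHalfPlane
  sideC : HypHalfPlane
  angleA : sideB.MeetAtAngle sideC α
  angleB : sideC.MeetAtAngle sideA β
  angleC : sideA.MeetAtAngle sideB γ
  nonempty' : (sideA.carrier ∩ sideB.carrier ∩ sideC.carrier).Nonempty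

namespace HypTriangle

variable {α β γ : ℝ}

/-- The points of the triangle. -/
def carrier (T : HypTriangle α β γ) : Set ℍ :=
  T.sideA.carrier ∩ T.sideB.carrier ∩ T.sideC.carrier

/-- The union of the three sides of the triangle. -/
def boundary (T : HypTriangle α β γ) : Set T.carrier :=
  {z | (z : ℍ) ∈ T.sideA.line ∪ T.sideB.line ∪ T.sideC.line}

theorem boundary_nonempty (T : HypTriangle α β γ) : T.boundary.Nonempty := by
  obtain ⟨z, ⟨hA, hB⟩, hC⟩ := T.nonempty'
  obtain ⟨w, hw⟩ := T.sideA.exists_eval_neg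
  let m : ℍ → ℝ := fun x => min (min (T.sideA.eval x) (T.sideB.eval x)) (T.sideC.eval x)
  have hm : Continuous m :=
    (T.sideA.continuous_eval.min T.sideB.continuous_eval).min T.sideC.continuous_eval
  have hz : 0 ≤ m z := le_min (le_min hA hB) hC
  have hw' : m w ≤ 0 := (min_le_left _ _).trans ((min_le_left _ _).trans hw.le)
  obtain ⟨x, hx⟩ := mem_range_of_exists_le_of_exists_ge hm ⟨w, hw'⟩ ⟨z, hz⟩
  have h1 : 0 ≤ min (T.sideA.eval x) (T.sideB.eval x) := hx.ge.trans (min_le_left _ _)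
  have h2 : 0 ≤ T.sideC.eval x := hx.ge.trans (min_le_right _ _)
  refine ⟨⟨x, ⟨h1.trans (min_le_left _ _), h1.trans (min_le_right _ _)⟩, h2⟩, ?_⟩
  rcases min_choice (min (T.sideA.eval x) (T.sideB.eval x)) (T.sideC.eval x) with h | h
  · rcases min_choice (T.sideA.eval x) (T.sideB.eval x) with h' | h'
    · exact Or.inl (Or.inl (h'.symm.trans (h.symm.trans hx)))
    · exact Or.inl (Or.inr (h'.symm.trans (h.symm.trans hx)))
  · exact Or.inr (h.symm.trans hx)

instance (T : HypTriangle α β γ) : Nonempty T.boundary := T.boundary_nonempty.to_subtype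

theorem isometry_boundary (T : HypTriangle α β γ) :
    Isometry (Subtype.val : T.boundary → T.carrier) := isometry_subtype_coe

/-- The triangular surface `S_{α,β,γ}`: two copies of the triangle glued along corresponding sides
by the identity; when the angles lie in `[0, π/2]` it is a sphere with three singular points of
total angles `2α, 2β, 2γ`, where total angle `0` means a cusp, which is not a point of the surface. Two points of the same copy are at their hyperbolic distance; points `x, y` of
different copies are at distance `inf (d(x, z) + d(z, y))` over the points `z` of the sides. -/
abbrev Surface (T : HypTriangle α β γ) : Type :=
  Metric.GlueSpace T.isometry_boundary T.isometry_boundary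

/-- Hyperbolic triangles with prescribed angles in `[0, π/2]` exist. -/
theorem exists_of_angles (hα : α ∈ Icc 0 (Real.pi / 2)) (hβ : β ∈ Icc 0 (Real.pi / 2))
    (hγ : γ ∈ Icc 0 (Real.pi / 2)) (h : α + β + γ < Real.pi) :
    Nonempty (HypTriangle α β γ) := by
  have cα : 0 ≤ Real.cos α := Real.cos_nonneg_of_mem_Icc ⟨by linarith [hα.1, Real.pi_pos], hα.2⟩
  have cβ : 0 ≤ Real.cos β := Real.cos_nonneg_of_mem_Icc ⟨by linarith [hβ.1, Real.pi_pos], hβ.2⟩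
  have sα : 0 ≤ Real.sin α := Real.sin_nonneg_of_nonneg_of_le_pi hα.1 (by linarith [hα.2, hα.1])
  have sβ : 0 ≤ Real.sin β := Real.sin_nonneg_of_nonneg_of_le_pi hβ.1 (by linarith [hβ.2, hβ.1])
  have key : Real.sin α * Real.sin β < Real.cos γ + Real.cos α * Real.cos β := by
    have := Real.cos_lt_cos_of_nonneg_of_le_pi hγ.1
      (by linarith [hα.1, hβ.1] : Real.pi - (α + β) ≤ Real.pi) (by linarith)
    rw [Real.cos_pi_sub, Real.cos_add] at this
    linarith
  have e1 := Real.sin_sq_add_cos_sq α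
  have e2 := Real.sin_sq_add_cos_sq β
  set K := Real.cos γ + Real.cos α * Real.cos β with hK
  set s := Real.sin α
  set t := Real.sin β
  have hst : 0 ≤ s * t := mul_nonneg sα sβ
  have hKpos : 0 < K := hst.trans_lt key
  have hD0 : 0 ≤ K ^ 2 - (s * t) ^ 2 := by nlinarith
  set D := √(K ^ 2 - (s * t) ^ 2) with hD
  have hD1 : 0 ≤ D := Real.sqrt_nonneg _
  have hD2 : D ^ 2 = K ^ 2 - (s * t) ^ 2 := Real.sq_sqrt hD0
  have hKD : 0 < K + D := by linarith
  obtain ⟨y, hy0, hy1, hy2⟩ : ∃ y : ℝ, 0 < y ∧ t ≤ y ∧ s * y ≤ K + D := by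
    rcases eq_or_lt_of_le sα with h0 | h0
    · exact ⟨1, one_pos, Real.sin_le_one β, by rw [← h0]; linarith⟩
    · refine ⟨(K + D) / s, by positivity, ?_, ?_⟩
      · rw [le_div_iff₀ h0]; nlinarith
      · rw [mul_div_cancel₀ _ h0.ne']
  refine ⟨⟨⟨1 / 2, -Real.cos β, -t ^ 2 / 2, ?_⟩,
    ⟨-(s ^ 2 / (2 * (K + D))), -Real.cos α, (K + D) / 2, ?_⟩, ⟨0, 1, 0, by norm_num⟩,
    ?_, ?_, ?_, ⟨⟨⟨0, y⟩, hy0⟩, ⟨?_, ?_⟩, ?_⟩⟩⟩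
  · linarith
  · field_simp
    linarith
  · simp [HypHalfPlane.MeetAtAngle, HypHalfPlane.normalInner]
  · simp [HypHalfPlane.MeetAtAngle, HypHalfPlane.normalInner]
  · simp only [HypHalfPlane.MeetAtAngle, HypHalfPlane.normalInner]
    field_simp
    nlinarith
  · change 0 ≤ 1 / 2 * ((0 : ℝ) ^ 2 + y ^ 2) + -Real.cos β * 0 + -t ^ 2 / 2
    nlinarith
  · change 0 ≤ -(s ^ 2 / (2 * (K + D))) * ((0 : ℝ) ^ 2 + y ^ 2) + -Real.cos α * 0 + (K + D) / 2
    have : s ^ 2 / (2 * (K + D)) * y ^ 2 ≤ (K + D) / 2 := by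
      rw [div_mul_eq_mul_div, div_le_div_iff₀ (by positivity) (by norm_num)]
      have : (s * y) ^ 2 ≤ (K + D) ^ 2 := pow_le_pow_left₀ (mul_nonneg sα hy0.le) hy2 2
      nlinarith
    nlinarith
  · change 0 ≤ (0 : ℝ) * ((0 : ℝ) ^ 2 + y ^ 2) + 1 * 0 + 0
    norm_num

end HypTriangle

/-- The open ball `B_r(p)` of the surface `X` is isometric, for the intrinsic metrics, to an open
disk of radius `r` in `ℍ`: there is a homeomorphism from such a disk onto `B_r(p)` that is locally
distance preserving. (The distance of the surface between two points of an embedded disk may be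
realised outside of the disk, so distances are only compared locally.) -/
def IsEmbeddedDisk {X : Type*} [MetricSpace X] (p : X) (r : ℝ) : Prop :=
  ∃ (o : ℍ) (φ : Metric.ball o r ≃ₜ Metric.ball p r),
    ∀ x, ∃ U ∈ 𝓝 x, ∀ y ∈ U, ∀ z ∈ U, dist (φ y) (φ z) = dist y z

/-- The injectivity radius `r_p`: the largest `r ≥ 0` such that `B_r(p)` is isometric to an open
disk of radius `r` in `ℍ`, as a supremum in `[0, ∞]`. -/
def injRadius {X : Type*} [MetricSpace X] (p : X) : ℝ≥0∞ :=
  ⨆ (r : ℝ≥0) (_ : IsEmbeddedDisk p r), (r : ℝ≥0∞)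

/-- The maximum injectivity radius `r(X)`, as a supremum in `[0, ∞]`. -/
def maxInjRadius (X : Type*) [MetricSpace X] : ℝ≥0∞ :=
  ⨆ p : X, injRadius p

end

/-! Let the height of a point over a line be the hyperbolic sine of its signed distance. In the
hyperboloid model this is the pairing with the unit normal, so reflections, distances and the
relations between the three heights are all polynomial.

Fix a point `p` of one face. The distance between its mirror images in two sides is the length of
the geodesic loop at `p` around their common vertex. The ball of radius `r` about `p` is an embedded
disk exactly when all three distances are at least `2 r`. If they are, folding the disk along the
sides is injective and locally isometric (`IsDouble.isEmbeddedDisk`). If two images are closer, part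
of the other face is reached across two sides at once, so the ball has less area than the disk
(`IsDouble.mirrorsSeparated`); this direction uses that no angle is obtuse.

Let `u, v, w` be the cosines of the angles and `a, b, c` the heights of `p`. The triples that occur
are the nonnegative ones with `gramForm = gramDisc` (`gram_relation`, `HypTriangle.exists_point`),
and the loop condition reads `sinh² r ≤ b² + c² + 2ubc` together with its cyclic analogues. Thus the
maximum injectivity radius depends on `AdmitsLoops` alone (`HypTriangle.maxInjRadius_eq`).

Smaller angles mean larger cosines. Increase `u` with `a, b, c` fixed: no loop gets shorter, while
`gramDisc - gramForm` becomes positive, because its derivative is bounded below by the loops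
(`le_derivative`). Scaling `a, b, c` up restores the equation and lengthens all loops
(`AdmitsLoops.step`). The scaling factor is uniform over all loops above a given size, so the
supremum increases strictly even if it is not known to be attained (`loopRadius_lt`). -/

noncomputable section

open UpperHalfPlane MeasureTheory

/-! ### Heights over lines. -/

namespace HypHalfPlane

/-- The sine-hyperbolic of the signed distance of `z` to the boundary line of `H`. -/
def height (H : HypHalfPlane) (z : ℍ) : ℝ := H.eval z / z.im

theorem mem_carrier_iff (H : HypHalfPlane) (z : ℍ) : z ∈ H.carrier ↔ 0 ≤ H.height z := by
  simp [carrier, height, div_nonneg_iff, z.im_pos.le, z.im_pos.not_ge]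

theorem mem_line_iff (H : HypHalfPlane) (z : ℍ) : z ∈ H.line ↔ H.height z = 0 := by
  simp [line, height, z.im_ne_zero]

theorem continuous_height (H : HypHalfPlane) : Continuous H.height :=
  H.continuous_eval.div UpperHalfPlane.continuous_im fun z => z.im_ne_zero

theorem normalInner_comm (H K : HypHalfPlane) : normalInner H K = normalInner K H := by
  unfold normalInner; ring

theorem normalInner_self (H : HypHalfPlane) : normalInner H H = 1 := by
  have := H.normalized
  unfold normalInner; linarith

end HypHalfPlane

/-! ### The hyperboloid model. -/

namespace UpperHalfPlane

/-- The first coordinate of `z` in the hyperboloid model `X Z - Y² = 1`, `0 < X`. -/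
def coordX (z : ℍ) : ℝ := 1 / z.im

/-- The second coordinate of `z` in the hyperboloid model `X Z - Y² = 1`, `0 < X`. -/
def coordY (z : ℍ) : ℝ := z.re / z.im

/-- The third coordinate of `z` in the hyperboloid model `X Z - Y² = 1`, `0 < X`. -/
def coordZ (z : ℍ) : ℝ := (z.re ^ 2 + z.im ^ 2) / z.im

theorem coordX_pos (z : ℍ) : 0 < z.coordX := one_div_pos.2 z.im_pos

theorem coord_eq (z : ℍ) : z.coordX * z.coordZ - z.coordY ^ 2 = 1 := by
  have := z.im_ne_zero
  unfold coordX coordY coordZ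
  field_simp
  ring

/-- The point of the upper half-plane with given hyperboloid coordinates. -/
def ofCoord (X Y : ℝ) (hX : 0 < X) : ℍ := ⟨⟨Y / X, 1 / X⟩, one_div_pos.2 hX⟩

theorem coordX_ofCoord {X Y : ℝ} (hX : 0 < X) : (ofCoord X Y hX).coordX = X := by
  change 1 / (1 / X) = X
  simp

theorem coordY_ofCoord {X Y : ℝ} (hX : 0 < X) : (ofCoord X Y hX).coordY = Y := by
  change Y / X / (1 / X) = Y
  field_simp

theorem coordZ_ofCoord {X Y Z : ℝ} (hX : 0 < X) (h : X * Z - Y ^ 2 = 1) :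
    (ofCoord X Y hX).coordZ = Z := by
  have h1 := coord_eq (ofCoord X Y hX)
  rw [coordX_ofCoord, coordY_ofCoord, ← h] at h1
  exact mul_left_cancel₀ hX.ne' (by linarith)

theorem exists_coord {X Y Z : ℝ} (hX : 0 < X) (h : X * Z - Y ^ 2 = 1) :
    ∃ z : ℍ, z.coordX = X ∧ z.coordY = Y ∧ z.coordZ = Z :=
  ⟨ofCoord X Y hX, coordX_ofCoord hX, coordY_ofCoord hX, coordZ_ofCoord hX h⟩

theorem cosh_dist_eq_coord (z w : ℍ) : Real.cosh (dist z w) =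
    (z.coordX * w.coordZ + z.coordZ * w.coordX) / 2 - z.coordY * w.coordY := by
  have h1 := z.im_ne_zero
  have h2 := w.im_ne_zero
  rw [cosh_dist']
  unfold coordX coordY coordZ
  field_simp
  ring

theorem height_eq_coord (H : HypHalfPlane) (z : ℍ) :
    H.height z = H.a * z.coordZ + H.b * z.coordY + H.c * z.coordX := by
  have h1 := z.im_ne_zero
  unfold HypHalfPlane.height HypHalfPlane.eval coordX coordY coordZ
  field_simp

theorem ext_coord {z w : ℍ} (hX : z.coordX = w.coordX) (hY : z.coordY = w.coordY) : z = w := by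
  have h1 := z.im_ne_zero
  have h2 := w.im_ne_zero
  have him : z.im = w.im := by
    unfold coordX at hX
    simpa using hX
  have hre : z.re = w.re := by
    unfold coordY at hY
    rw [him] at hY
    field_simp at hY
    exact hY
  exact UpperHalfPlane.ext (Complex.ext hre him)

end UpperHalfPlane

/-! ### Reflections as Lorentz reflections. -/

namespace HypHalfPlane

/-- Multiplied by `X > 0` the expression becomes `(bX + 2aY)² + 4a²`, so the linear reflection
preserves the sheet `X > 0`. -/
theorem reflect_coordX_pos (H : HypHalfPlane) (z : ℍ) :
    0 < z.coordX + 4 * H.a * H.height z := by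
  have hX := z.coordX_pos
  have h := z.coord_eq
  have hn := H.normalized
  rw [height_eq_coord]
  set X := z.coordX
  set Y := z.coordY
  set Z := z.coordZ
  have e : (X + 4 * H.a * (H.a * Z + H.b * Y + H.c * X)) * X
      = (H.b * X + 2 * H.a * Y) ^ 2 + 4 * H.a ^ 2 := by
    linear_combination (4 * H.a ^ 2) * h - X ^ 2 * hn
  refine pos_of_mul_pos_left ?_ hX.le
  rw [e]
  by_cases ha : H.a = 0
  · rw [ha] at hn ⊢
    have : H.b ^ 2 = 1 := by linarith
    have h3 : 0 < H.b ^ 2 * X ^ 2 := by rw [this]; positivity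
    nlinarith
  · positivity

/-- The reflection of the hyperbolic plane in the boundary line of `H`. -/
def reflect (H : HypHalfPlane) (z : ℍ) : ℍ :=
  ofCoord (z.coordX + 4 * H.a * H.height z) (z.coordY - 2 * H.b * H.height z)
    (H.reflect_coordX_pos z)

theorem coordX_reflect (H : HypHalfPlane) (z : ℍ) :
    (H.reflect z).coordX = z.coordX + 4 * H.a * H.height z := coordX_ofCoord _

theorem coordY_reflect (H : HypHalfPlane) (z : ℍ) :
    (H.reflect z).coordY = z.coordY - 2 * H.b * H.height z := coordY_ofCoord _

theorem coordZ_reflect (H : HypHalfPlane) (z : ℍ) :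
    (H.reflect z).coordZ = z.coordZ + 4 * H.c * H.height z := by
  refine coordZ_ofCoord _ ?_
  rw [height_eq_coord]
  linear_combination z.coord_eq -
    4 * (H.a * z.coordZ + H.b * z.coordY + H.c * z.coordX) ^ 2 * H.normalized

theorem height_reflect (H K : HypHalfPlane) (z : ℍ) :
    K.height (H.reflect z) = K.height z - 2 * normalInner H K * H.height z := by
  rw [height_eq_coord K, coordX_reflect, coordY_reflect, coordZ_reflect, height_eq_coord K z]
  unfold normalInner
  ring

theorem height_reflect_self (H : HypHalfPlane) (z : ℍ) :
    H.height (H.reflect z) = -H.height z := by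
  rw [height_reflect, normalInner_self]; ring

/-- Here `cosh dist` is minus the Lorentz pairing and the reflection is `x - 2⟨x, n⟩n`. The sign of
the product of the heights decides whether a point or its mirror image is nearer to `w`. -/
theorem cosh_dist_reflect (H : HypHalfPlane) (z w : ℍ) :
    Real.cosh (dist (H.reflect z) w) = Real.cosh (dist z w) + 2 * H.height z * H.height w := by
  rw [cosh_dist_eq_coord, cosh_dist_eq_coord, coordX_reflect, coordY_reflect, coordZ_reflect,
    height_eq_coord H w]
  ring

theorem reflect_reflect (H : HypHalfPlane) (z : ℍ) : H.reflect (H.reflect z) = z := by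
  apply ext_coord
  · rw [coordX_reflect, height_reflect_self, coordX_reflect]; ring
  · rw [coordY_reflect, height_reflect_self, coordY_reflect]; ring

theorem reflect_of_height_eq_zero (H : HypHalfPlane) {z : ℍ} (h : H.height z = 0) :
    H.reflect z = z := by
  apply ext_coord
  · rw [coordX_reflect, h]; ring
  · rw [coordY_reflect, h]; ring

theorem dist_reflect_reflect (H : HypHalfPlane) (z w : ℍ) :
    dist (H.reflect z) (H.reflect w) = dist z w := by
  have h : Real.cosh (dist (H.reflect z) (H.reflect w)) = Real.cosh (dist z w) := by
    rw [cosh_dist_reflect, height_reflect_self, dist_comm z, cosh_dist_reflect, dist_comm w]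
    ring
  exact (Real.cosh_injOn.eq_iff dist_nonneg dist_nonneg).1 h

theorem dist_reflect_comm (H : HypHalfPlane) (z w : ℍ) :
    dist (H.reflect z) w = dist z (H.reflect w) := by
  rw [← dist_reflect_reflect H z, reflect_reflect]

theorem isometry_reflect (H : HypHalfPlane) : Isometry H.reflect :=
  Isometry.of_dist_eq H.dist_reflect_reflect

theorem cosh_le_cosh_dist {x y z w : ℍ} :
    Real.cosh (dist x y) ≤ Real.cosh (dist z w) ↔ dist x y ≤ dist z w := by
  rw [Real.cosh_le_cosh, abs_of_nonneg dist_nonneg, abs_of_nonneg dist_nonneg]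

theorem dist_le_dist_reflect (H : HypHalfPlane) {z w : ℍ} (h : 0 ≤ H.height z * H.height w) :
    dist z w ≤ dist (H.reflect z) w := by
  rw [← cosh_le_cosh_dist, cosh_dist_reflect]
  linarith

theorem dist_reflect_le_dist (H : HypHalfPlane) {z w : ℍ} (h : H.height z * H.height w ≤ 0) :
    dist (H.reflect z) w ≤ dist z w := by
  rw [← cosh_le_cosh_dist, cosh_dist_reflect]
  linarith

/-- The distance between the images of a point under two reflections. -/
theorem cosh_dist_reflect_reflect (H K : HypHalfPlane) (z : ℍ) :
    Real.cosh (dist (H.reflect z) (K.reflect z)) = 1 + 2 * (H.height z ^ 2 + K.height z ^ 2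
      - 2 * normalInner H K * H.height z * K.height z) := by
  rw [cosh_dist_reflect, dist_comm, cosh_dist_reflect, dist_self, Real.cosh_zero, height_reflect,
    normalInner_comm K H]
  ring

end HypHalfPlane

/-! ### Points of geodesic segments. -/

/-- Normalised nonnegative combinations of two points in the hyperboloid model. -/
theorem exists_combination (p z : ℍ) {l m : ℝ} (hl : 0 ≤ l) (hm : 0 ≤ m) (hlm : 0 < l + m) :
    ∃ u : ℍ, ∃ N : ℝ, 0 < N ∧ N ^ 2 = l ^ 2 + m ^ 2 + 2 * l * m * Real.cosh (dist p z) ∧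
      (∀ H : HypHalfPlane, H.height u = (l * H.height p + m * H.height z) / N) ∧
      ∀ x, Real.cosh (dist u x) =
        (l * Real.cosh (dist p x) + m * Real.cosh (dist z x)) / N := by
  have hpos : 0 < l ^ 2 + m ^ 2 + 2 * l * m * Real.cosh (dist p z) := by
    have h1 : 0 ≤ 2 * l * m * (Real.cosh (dist p z) - 1) := by
      have := Real.one_le_cosh (dist p z)
      have : 0 ≤ Real.cosh (dist p z) - 1 := by linarith
      positivity
    nlinarith [pow_pos hlm 2]
  set N := √(l ^ 2 + m ^ 2 + 2 * l * m * Real.cosh (dist p z)) with hN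
  have hN0 : 0 < N := Real.sqrt_pos.2 hpos
  have hN2 : N ^ 2 = l ^ 2 + m ^ 2 + 2 * l * m * Real.cosh (dist p z) := Real.sq_sqrt hpos.le
  have hX : 0 < (l * p.coordX + m * z.coordX) / N := by
    apply div_pos _ hN0
    rcases hl.eq_or_lt with h | h
    · have : 0 < m := by linarith
      have := mul_pos this z.coordX_pos
      rw [← h]; linarith
    · have := mul_pos h p.coordX_pos
      have := mul_nonneg hm z.coordX_pos.le
      linarith
  obtain ⟨u, hu1, hu2, hu3⟩ := exists_coord (X := (l * p.coordX + m * z.coordX) / N)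
    (Y := (l * p.coordY + m * z.coordY) / N) (Z := (l * p.coordZ + m * z.coordZ) / N) hX (by
      rw [cosh_dist_eq_coord] at hN2
      field_simp
      linear_combination (l ^ 2) * p.coord_eq + (m ^ 2) * z.coord_eq - hN2)
  refine ⟨u, N, hN0, hN2, fun H => ?_, fun x => ?_⟩
  · rw [height_eq_coord, height_eq_coord, height_eq_coord, hu1, hu2, hu3]
    field_simp
    ring
  · rw [cosh_dist_eq_coord, cosh_dist_eq_coord, cosh_dist_eq_coord, hu1, hu2, hu3]
    field_simp
    ring

/-- A geodesic segment between two points on different sides of a line crosses the line. -/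
theorem exists_crossing (H : HypHalfPlane) {p z : ℍ} (hp : 0 ≤ H.height p) (hz : H.height z < 0) :
    ∃ u : ℍ, H.height u = 0 ∧ dist p u + dist u z = dist p z := by
  -- With these weights the two contributions to the height of `u` cancel.
  obtain ⟨u, N, hN, hN2, hH, hd⟩ := exists_combination p z (l := -H.height z) (m := H.height p)
    (by linarith) hp (by linarith)
  refine ⟨u, ?_, ?_⟩
  · rw [hH]; field_simp; ring
  set l := -H.height z
  set m := H.height p
  have hl : 0 < l := by simp only [l]; linarith
  set C := Real.cosh (dist p z)
  set S := Real.sinh (dist p z)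
  have hCS : C ^ 2 = S ^ 2 + 1 := Real.cosh_sq _
  have hS : 0 ≤ S := Real.sinh_nonneg_iff.2 dist_nonneg
  have c1 : Real.cosh (dist p u) = (l + m * C) / N := by
    rw [dist_comm, hd, dist_self, Real.cosh_zero, dist_comm z p]; ring
  have c2 : Real.cosh (dist u z) = (l * C + m) / N := by
    rw [hd, dist_self, Real.cosh_zero]; ring
  have s1 : Real.sinh (dist p u) = m * S / N := by
    have h1 : 0 ≤ Real.sinh (dist p u) := Real.sinh_nonneg_iff.2 dist_nonneg
    have h2 : 0 ≤ m * S / N := by positivity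
    rw [← sq_eq_sq₀ h1 h2, Real.sinh_sq, c1]
    field_simp
    linear_combination m ^ 2 * hCS - hN2
  have s2 : Real.sinh (dist u z) = l * S / N := by
    have h1 : 0 ≤ Real.sinh (dist u z) := Real.sinh_nonneg_iff.2 dist_nonneg
    have h2 : 0 ≤ l * S / N := by positivity
    rw [← sq_eq_sq₀ h1 h2, Real.sinh_sq, c2]
    field_simp
    linear_combination l ^ 2 * hCS - hN2
  have h : Real.cosh (dist p u + dist u z) = Real.cosh (dist p z) := by
    rw [Real.cosh_add, c1, c2, s1, s2]
    change _ = C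
    field_simp
    linear_combination (-l * m) * hCS - C * hN2
  exact Real.cosh_injOn (add_nonneg dist_nonneg dist_nonneg) dist_nonneg h

/-! ### Polygons and their doubles. -/

/-- The polygon cut out by a family of half-planes. -/
def polygon {ι : Type*} (H : ι → HypHalfPlane) : Set ℍ := {z | ∀ i, 0 ≤ (H i).height z}

/-- The union of the sides of a polygon. -/
def polygonBoundary {ι : Type*} (H : ι → HypHalfPlane) : Set ℍ :=
  {z | z ∈ polygon H ∧ ∃ i, (H i).height z = 0}

/-- `X` is the double of the polygon cut out by `H`, the two copies being the images of the polygon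
under `f` and `g`. -/
structure IsDouble {ι : Type*} (H : ι → HypHalfPlane) {X : Type*} [MetricSpace X]
    (f g : ℍ → X) : Prop where
  dist_left : ∀ x ∈ polygon H, ∀ y ∈ polygon H, dist (f x) (f y) = dist x y
  dist_right : ∀ x ∈ polygon H, ∀ y ∈ polygon H, dist (g x) (g y) = dist x y
  eq_of_mem_boundary : ∀ x ∈ polygonBoundary H, f x = g x
  exists_of_dist_lt : ∀ x ∈ polygon H, ∀ y ∈ polygon H, ∀ r, dist (f x) (g y) < r →
    ∃ w ∈ polygonBoundary H, dist x w + dist w y < r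
  cover : ∀ q, (∃ x ∈ polygon H, f x = q) ∨ ∃ x ∈ polygon H, g x = q

namespace IsDouble

variable {ι : Type*} {H : ι → HypHalfPlane} {X : Type*} [MetricSpace X] {f g : ℍ → X}

theorem dist_le (h : IsDouble H f g) {x y w : ℍ} (hx : x ∈ polygon H) (hy : y ∈ polygon H)
    (hw : w ∈ polygonBoundary H) : dist (f x) (g y) ≤ dist x w + dist w y := by
  rw [← h.dist_left x hx w hw.1, ← h.dist_right w hw.1 y hy, h.eq_of_mem_boundary w hw]
  exact dist_triangle _ _ _

theorem symm (h : IsDouble H f g) : IsDouble H g f where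
  dist_left := h.dist_right
  dist_right := h.dist_left
  eq_of_mem_boundary x hx := (h.eq_of_mem_boundary x hx).symm
  exists_of_dist_lt x hx y hy r hr := by
    rw [dist_comm] at hr
    obtain ⟨w, hw, hwr⟩ := h.exists_of_dist_lt y hy x hx r hr
    exact ⟨w, hw, by rwa [dist_comm x w, dist_comm w y, add_comm]⟩
  cover q := (h.cover q).symm

end IsDouble

/-! ### Folding a disk into the double. -/

section Disk

variable {ι : Type*} {H : ι → HypHalfPlane} {p : ℍ} {r : ℝ}

/-- The condition on `p` and `r` that says that the mirror images of `p` in the sides of the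
polygon are pairwise at distance at least `2 r`. -/
def MirrorsSeparated (H : ι → HypHalfPlane) (p : ℍ) (r : ℝ) : Prop :=
  ∀ i j, i ≠ j → 2 * r ≤ dist ((H i).reflect p) ((H j).reflect p)

/-- A point on or beyond a side is at least as close to the mirror image of `p` in that side as to
`p`. On or beyond two sides, it would be within `r` of two mirror images. -/
theorem MirrorsSeparated.height_pos (hr : MirrorsSeparated H p r) (hp : p ∈ polygon H) {z : ℍ}
    (hz : dist p z < r) {i j : ι} (hij : i ≠ j) (hi : (H i).height z ≤ 0) :
    0 < (H j).height z := by
  by_contra! hj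
  have h1 := (H i).dist_reflect_le_dist (mul_nonpos_of_nonneg_of_nonpos (hp i) hi)
  have h2 := (H j).dist_reflect_le_dist (mul_nonpos_of_nonneg_of_nonpos (hp j) hj)
  have h3 := dist_triangle_right ((H i).reflect p) ((H j).reflect p) z
  linarith [hr i j hij]

/-- Otherwise the folded point would lie within `r` of the mirror images in both sides `i` and `j`.
Hence a single reflection folds each point of the disk into the polygon. -/
theorem MirrorsSeparated.height_reflect_pos (hr : MirrorsSeparated H p r) (hp : p ∈ polygon H)
    {z : ℍ} (hz : dist p z < r) {i j : ι} (hij : i ≠ j) (hi : (H i).height z ≤ 0) :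
    0 < (H j).height ((H i).reflect z) := by
  by_contra! hj
  have h0 : 0 ≤ (H i).height ((H i).reflect z) := by
    rw [HypHalfPlane.height_reflect_self]; linarith
  have h1 := (H j).dist_reflect_le_dist (mul_nonpos_of_nonneg_of_nonpos (hp j) hj)
  have h2 := (H i).dist_le_dist_reflect (mul_nonneg (hp i) h0)
  have h3 := dist_triangle_right ((H i).reflect p) ((H j).reflect p) ((H i).reflect z)
  rw [HypHalfPlane.dist_reflect_reflect] at h2 h3
  linarith [hr i j hij]

theorem MirrorsSeparated.reflect_mem (hr : MirrorsSeparated H p r) (hp : p ∈ polygon H)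
    {z : ℍ} (hz : dist p z < r) {i : ι} (hi : (H i).height z ≤ 0) :
    (H i).reflect z ∈ polygon H := by
  intro j
  by_cases hij : i = j
  · subst hij
    rw [HypHalfPlane.height_reflect_self]; linarith
  · exact (hr.height_reflect_pos hp hz hij hi).le

theorem MirrorsSeparated.exists_side [Nonempty ι] (hr : MirrorsSeparated H p r)
    (hp : p ∈ polygon H) {z : ℍ} (hz : dist p z < r) : ∃ i, ∀ j, j ≠ i → 0 < (H j).height z := by
  by_cases h : ∃ i, (H i).height z ≤ 0
  · obtain ⟨i, hi⟩ := h
    exact ⟨i, fun j hj => hr.height_pos hp hz hj.symm hi⟩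
  · push Not at h
    exact ⟨Classical.arbitrary ι, fun j _ => h j⟩

open Classical in
/-- The map that folds the plane along the sides of a polygon into the double of the polygon. -/
def foldMap {X : Type*} (H : ι → HypHalfPlane) (f g : ℍ → X) (z : ℍ) : X :=
  if h : ∃ i, (H i).height z < 0 then g ((H h.choose).reflect z) else f z

theorem foldMap_of_mem {X : Type*} {f g : ℍ → X} {z : ℍ} (hz : z ∈ polygon H) : foldMap H f g z = f z :=
  dif_neg (by push Not; exact hz)

variable {X : Type*} [MetricSpace X] {f g : ℍ → X}

theorem foldMap_of_nonpos (h : IsDouble H f g) (hr : MirrorsSeparated H p r) (hp : p ∈ polygon H)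
    {z : ℍ} (hz : dist p z < r) {i : ι} (hi : (H i).height z ≤ 0) :
    foldMap H f g z = g ((H i).reflect z) := by
  by_cases h0 : ∃ i, (H i).height z < 0
  · have : h0.choose = i := by
      by_contra hne
      linarith [hr.height_pos hp hz hne h0.choose_spec.le]
    rw [foldMap, dif_pos h0, this]
  · have hzm : z ∈ polygon H := by push Not at h0; exact h0
    have hi0 : (H i).height z = 0 := le_antisymm hi (hzm i)
    rw [foldMap_of_mem hzm, (H i).reflect_of_height_eq_zero hi0]
    exact h.eq_of_mem_boundary z ⟨hzm, i, hi0⟩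

/-- Points on both sides of one side of the polygon, far from the other sides. -/
theorem dist_left_reflect (h : IsDouble H f g) {i : ι} {x y z : ℍ} {ε : ℝ}
    (hpos : ∀ w, dist x w < 4 * ε → ∀ j, j ≠ i → 0 < (H j).height w)
    (hy : dist x y < ε) (hz : dist x z < ε) (hyi : 0 ≤ (H i).height y) (hzi : (H i).height z < 0)
    (hzr : (H i).reflect z ∈ polygon H) : dist (f y) (g ((H i).reflect z)) = dist y z := by
  have hyz : dist y z < 2 * ε := by linarith [dist_triangle_left y z x]
  have hε : 0 < ε := dist_nonneg.trans_lt hy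
  have hmem : ∀ w, dist x w < 4 * ε → 0 ≤ (H i).height w → w ∈ polygon H := by
    intro w hw hwi j
    by_cases hj : j = i
    · rwa [hj]
    · exact (hpos w hw j hj).le
  have hym : y ∈ polygon H := hmem y (by linarith) hyi
  apply le_antisymm
  · obtain ⟨u, hu, hyu⟩ := exists_crossing (H i) hyi hzi
    have hxu : dist x u < 4 * ε := by
      have := dist_triangle x y u
      have := dist_nonneg (x := u) (y := z)
      linarith
    have := h.dist_le hym hzr (w := u) ⟨hmem u hxu hu.ge, i, hu⟩
    have e : dist u ((H i).reflect z) = dist u z := by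
      rw [← HypHalfPlane.dist_reflect_comm, (H i).reflect_of_height_eq_zero hu]
    rw [e, hyu] at this
    exact this
  · by_contra! hlt
    obtain ⟨w, ⟨hw, j, hj⟩, hwd⟩ := h.exists_of_dist_lt y hym _ hzr _ hlt
    -- A gluing point that shortens the path satisfies `dist y w < dist y z < 2ε`, so it is within
    -- `3ε` of `x`, where only side `i` can be met.
    have hxw : dist x w < 4 * ε := by
      have := dist_triangle x y w
      have := dist_nonneg (x := w) (y := (H i).reflect z)
      linarith
    have hji : j = i := by
      by_contra hne
      linarith [hpos w hxw j hne]
    subst hji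
    rw [← HypHalfPlane.dist_reflect_comm, (H j).reflect_of_height_eq_zero hj] at hwd
    linarith [dist_triangle y w z]

/-- Local behaviour of the folding map in the disk. -/
theorem foldMap_local [Finite ι] [Nonempty ι] (h : IsDouble H f g) (hr : MirrorsSeparated H p r)
    (hp : p ∈ polygon H) {x : ℍ} (hx : dist p x < r) :
    ∃ ε > 0, (∀ y, dist x y < ε → dist p y < r) ∧
      (∀ y z, dist x y < ε → dist x z < ε → dist (foldMap H f g y) (foldMap H f g z) = dist y z) ∧
      (∀ q, dist (foldMap H f g x) q < ε → ∃ y, dist x y < ε ∧ foldMap H f g y = q) := by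
  obtain ⟨i, hi⟩ := hr.exists_side hp hx
  have ev1 : ∀ᶠ y in 𝓝 x, ∀ j, j ≠ i → 0 < (H j).height y := by
    rw [Filter.eventually_all]
    intro j
    by_cases hj : j = i
    · simp [hj]
    · filter_upwards [(H j).continuous_height.continuousAt.eventually_const_lt (hi j hj)] with y hy _
      exact hy
  have ev2 : ∀ᶠ y in 𝓝 x, dist p y < r :=
    (continuous_const.dist continuous_id).continuousAt.eventually_lt continuousAt_const hx
  -- When `x` is beyond side `i`, its image lies in the second copy; this keeps the other sides away
  -- from that image too.
  have ev3 : ∀ᶠ y in 𝓝 x, (H i).height x ≤ 0 → ∀ j, j ≠ i → 0 < (H j).height ((H i).reflect y) := by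
    rw [Filter.eventually_imp_distrib_left]
    intro hxi
    rw [Filter.eventually_all]
    intro j
    by_cases hj : j = i
    · simp [hj]
    · have hc := (H j).continuous_height.comp (H i).isometry_reflect.continuous
      filter_upwards [hc.continuousAt.eventually_const_lt
        (hr.height_reflect_pos hp hx (Ne.symm hj) hxi)] with y hy _
      exact hy
  obtain ⟨δ, hδ, hball⟩ := Metric.eventually_nhds_iff.1 (ev1.and (ev2.and ev3))
  have hpos : ∀ w, dist x w < 4 * (δ / 4) → ∀ j, j ≠ i → 0 < (H j).height w := fun w hw =>
    (hball (y := w) (by rw [dist_comm]; linarith)).1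
  have hdisk : ∀ y, dist x y < δ / 4 → dist p y < r := fun y hy =>
    (hball (y := y) (by rw [dist_comm]; linarith)).2.1
  have hpos' : (H i).height x ≤ 0 → ∀ w, dist x w < δ →
      ∀ j, j ≠ i → 0 < (H j).height ((H i).reflect w) := fun hxi w hw =>
    (hball (y := w) (by rw [dist_comm]; linarith)).2.2 hxi
  have hmem : ∀ y, dist x y < δ / 4 → 0 ≤ (H i).height y → y ∈ polygon H := by
    intro w hw hwi j
    by_cases hj : j = i
    · rwa [hj]
    · exact (hpos w (by linarith) j hj).le
  refine ⟨δ / 4, by linarith, hdisk, ?_, ?_⟩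
  · intro y z hy hz
    rcases le_or_gt 0 ((H i).height y) with hyi | hyi <;>
      rcases le_or_gt 0 ((H i).height z) with hzi | hzi
    · rw [foldMap_of_mem (hmem y hy hyi), foldMap_of_mem (hmem z hz hzi)]
      exact h.dist_left _ (hmem y hy hyi) _ (hmem z hz hzi)
    · rw [foldMap_of_mem (hmem y hy hyi), foldMap_of_nonpos h hr hp (hdisk z hz) hzi.le]
      exact dist_left_reflect h hpos hy hz hyi hzi (hr.reflect_mem hp (hdisk z hz) hzi.le)
    · rw [foldMap_of_mem (hmem z hz hzi), foldMap_of_nonpos h hr hp (hdisk y hy) hyi.le,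
        dist_comm, dist_comm y]
      exact dist_left_reflect h hpos hz hy hzi hyi (hr.reflect_mem hp (hdisk y hy) hyi.le)
    · rw [foldMap_of_nonpos h hr hp (hdisk z hz) hzi.le,
        foldMap_of_nonpos h hr hp (hdisk y hy) hyi.le,
        h.dist_right _ (hr.reflect_mem hp (hdisk y hy) hyi.le) _
          (hr.reflect_mem hp (hdisk z hz) hzi.le), HypHalfPlane.dist_reflect_reflect]
  · have back : ∀ y ∈ polygon H, dist x ((H i).reflect y) < δ / 4 →
        ∃ z, dist x z < δ / 4 ∧ foldMap H f g z = g y := by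
      intro y hy hxy
      refine ⟨(H i).reflect y, hxy, ?_⟩
      rw [foldMap_of_nonpos h hr hp (hdisk _ hxy) (i := i)
        (by rw [HypHalfPlane.height_reflect_self]; linarith [hy i]), HypHalfPlane.reflect_reflect]
    intro q hq
    rcases le_or_gt 0 ((H i).height x) with hxi | hxi
    · have hxm := hmem x (by rw [dist_self]; linarith) hxi
      rw [foldMap_of_mem hxm] at hq
      rcases h.cover q with ⟨y, hy, rfl⟩ | ⟨y, hy, rfl⟩
      · rw [h.dist_left x hxm y hy] at hq
        exact ⟨y, hq, foldMap_of_mem hy⟩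
      · obtain ⟨w, ⟨hw, j, hj⟩, hwd⟩ := h.exists_of_dist_lt x hxm y hy _ hq
        have hji : j = i := by
          by_contra hne
          linarith [hpos w (by linarith [dist_nonneg (x := w) (y := y)]) j hne]
        subst hji
        apply back y hy
        have := dist_triangle x w ((H j).reflect y)
        rw [← HypHalfPlane.dist_reflect_comm _ w, (H j).reflect_of_height_eq_zero hj] at this
        linarith
    · have hxm := hr.reflect_mem hp hx hxi.le
      rw [foldMap_of_nonpos h hr hp hx hxi.le] at hq
      rcases h.cover q with ⟨y, hy, rfl⟩ | ⟨y, hy, rfl⟩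
      · rw [dist_comm] at hq
        obtain ⟨w, ⟨hw, j, hj⟩, hwd⟩ := h.exists_of_dist_lt y hy _ hxm _ hq
        have hxw : dist x ((H i).reflect w) < δ / 4 := by
          rw [← HypHalfPlane.dist_reflect_comm, dist_comm]
          linarith [dist_nonneg (x := y) (y := w)]
        have hji : j = i := by
          by_contra hne
          have := hpos' hxi.le ((H i).reflect w) (by linarith) j hne
          rw [HypHalfPlane.reflect_reflect] at this
          linarith
        subst hji
        rw [← HypHalfPlane.dist_reflect_comm, (H j).reflect_of_height_eq_zero hj] at hwd
        have := dist_triangle y w x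
        exact ⟨y, by rw [dist_comm]; linarith, foldMap_of_mem hy⟩
      · rw [h.dist_right _ hxm y hy, HypHalfPlane.dist_reflect_comm] at hq
        exact back y hy hq

/-- A point strictly beyond a side folds to an interior point of the second copy, which is at
positive distance from the first copy. Two points folded across different sides to the same point
would put it within `r` of two mirror images. -/
theorem foldMap_injOn [Finite ι] (h : IsDouble H f g) (hr : MirrorsSeparated H p r)
    (hp : p ∈ polygon H) : InjOn (foldMap H f g) {z | dist p z < r} := by
  have key : ∀ y ∈ polygon H, ∀ z, dist p z < r → ∀ i, (H i).height z < 0 →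
      f y ≠ g ((H i).reflect z) := by
    intro y hy z hz i hi he
    have hzr := hr.reflect_mem hp hz hi.le
    have hpos : ∀ j, 0 < (H j).height ((H i).reflect z) := by
      intro j
      by_cases hij : i = j
      · subst hij; rw [HypHalfPlane.height_reflect_self]; linarith
      · exact hr.height_reflect_pos hp hz hij hi.le
    have hev : ∀ᶠ w in 𝓝 ((H i).reflect z), ∀ j, 0 < (H j).height w :=
      Filter.eventually_all.2 fun j =>
        (H j).continuous_height.continuousAt.eventually_const_lt (hpos j)
    obtain ⟨δ, hδ, hball⟩ := Metric.eventually_nhds_iff.1 hev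
    obtain ⟨w, ⟨-, j, hj⟩, hwd⟩ :=
      h.exists_of_dist_lt y hy _ hzr δ (by rw [he, dist_self]; exact hδ)
    have := hball (y := w) (by linarith [dist_nonneg (x := y) (y := w)]) j
    linarith
  intro y hy z hz hyz
  have hcase : ∀ z, z ∈ polygon H ∨ ∃ i, (H i).height z < 0 := by
    intro z
    by_cases h0 : ∃ i, (H i).height z < 0
    · exact Or.inr h0
    · push Not at h0; exact Or.inl h0
  rcases hcase y with hym | ⟨i, hi⟩ <;> rcases hcase z with hzm | ⟨j, hj⟩
  · rw [foldMap_of_mem hym, foldMap_of_mem hzm] at hyz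
    rw [← dist_eq_zero, ← h.dist_left y hym z hzm, hyz, dist_self]
  · rw [foldMap_of_mem hym, foldMap_of_nonpos h hr hp hz hj.le] at hyz
    exact absurd hyz (key y hym z hz j hj)
  · rw [foldMap_of_mem hzm, foldMap_of_nonpos h hr hp hy hi.le] at hyz
    exact absurd hyz.symm (key z hzm y hy i hi)
  · rw [foldMap_of_nonpos h hr hp hz hj.le, foldMap_of_nonpos h hr hp hy hi.le, ← dist_eq_zero,
      h.dist_right _ (hr.reflect_mem hp hy hi.le) _ (hr.reflect_mem hp hz hj.le), dist_eq_zero] at hyz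
    by_cases hij : i = j
    · subst hij
      rw [← (H i).reflect_reflect y, hyz, HypHalfPlane.reflect_reflect]
    · have h1 := dist_triangle_right ((H i).reflect p) ((H j).reflect p) ((H i).reflect y)
      rw [HypHalfPlane.dist_reflect_reflect, hyz, HypHalfPlane.dist_reflect_reflect] at h1
      have hy' : dist p y < r := hy
      have hz' : dist p z < r := hz
      linarith [hr i j hij]

theorem foldMap_mapsTo (h : IsDouble H f g) (hr : MirrorsSeparated H p r)
    (hp : p ∈ polygon H) {z : ℍ} (hz : dist p z < r) : dist (f p) (foldMap H f g z) < r := by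
  by_cases h0 : ∃ i, (H i).height z < 0
  · obtain ⟨i, hi⟩ := h0
    rw [foldMap_of_nonpos h hr hp hz hi.le]
    obtain ⟨u, hu, hpu⟩ := exists_crossing (H i) (hp i) hi
    have hur : dist p u < r := by linarith [dist_nonneg (x := u) (y := z)]
    have hum : u ∈ polygon H := by
      intro j
      by_cases hij : i = j
      · subst hij; exact hu.ge
      · exact (hr.height_pos hp hur hij hu.le).le
    have := h.dist_le hp (hr.reflect_mem hp hz hi.le) ⟨hum, i, hu⟩
    rw [← HypHalfPlane.dist_reflect_comm _ u, (H i).reflect_of_height_eq_zero hu] at this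
    linarith
  · have hzm : z ∈ polygon H := by push Not at h0; exact h0
    rw [foldMap_of_mem hzm, h.dist_left p hp z hzm]
    exact hz

theorem foldMap_surjOn (h : IsDouble H f g) (hr : MirrorsSeparated H p r)
    (hp : p ∈ polygon H) {q : X} (hq : dist (f p) q < r) :
    ∃ z, dist p z < r ∧ foldMap H f g z = q := by
  rcases h.cover q with ⟨y, hy, rfl⟩ | ⟨y, hy, rfl⟩
  · rw [h.dist_left p hp y hy] at hq
    exact ⟨y, hq, foldMap_of_mem hy⟩
  · obtain ⟨w, ⟨hw, i, hi⟩, hwd⟩ := h.exists_of_dist_lt p hp y hy _ hq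
    have hd : dist p ((H i).reflect y) < r := by
      have := dist_triangle p w ((H i).reflect y)
      rw [← HypHalfPlane.dist_reflect_comm _ w, (H i).reflect_of_height_eq_zero hi] at this
      linarith
    refine ⟨_, hd, ?_⟩
    rw [foldMap_of_nonpos h hr hp hd (i := i)
      (by rw [HypHalfPlane.height_reflect_self]; linarith [hy i]), HypHalfPlane.reflect_reflect]

/-- If the mirror images of `p` are at distance at least `2 r`, then the ball of radius `r` about
`p` in the double is an embedded disk. -/
theorem IsDouble.isEmbeddedDisk [Finite ι] [Nonempty ι] (h : IsDouble H f g)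
    (hr : MirrorsSeparated H p r) (hp : p ∈ polygon H) : IsEmbeddedDisk (f p) r := by
  let φ : Metric.ball p r → Metric.ball (f p) r := fun z =>
    ⟨foldMap H f g z, by
      rw [Metric.mem_ball, dist_comm]
      exact foldMap_mapsTo h hr hp (by rw [dist_comm]; exact z.2)⟩
  have hloc : ∀ x : Metric.ball p r, ∃ ε > 0,
      (∀ y z : Metric.ball p r, dist x y < ε → dist x z < ε → dist (φ y) (φ z) = dist y z) ∧
      (∀ q, dist (φ x) q < ε → ∃ y, dist x y < ε ∧ φ y = q) := by
    intro x
    obtain ⟨ε, hε, h1, h2, h3⟩ := foldMap_local h hr hp (x := x) (by rw [dist_comm]; exact x.2)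
    refine ⟨ε, hε, fun y z hy hz => h2 y z hy hz, fun q hq => ?_⟩
    obtain ⟨y, hy, hyq⟩ := h3 q hq
    exact ⟨⟨y, by rw [Metric.mem_ball, dist_comm]; exact h1 y hy⟩, hy, Subtype.ext hyq⟩
  have hcont : Continuous φ := by
    rw [Metric.continuous_iff']
    intro x η hη
    obtain ⟨ε, hε, h1, -⟩ := hloc x
    filter_upwards [Metric.ball_mem_nhds x (lt_min hε hη)] with y hy
    rw [Metric.mem_ball, lt_min_iff] at hy
    rw [h1 y x (by rw [dist_comm]; exact hy.1) (by rw [dist_self]; exact hε)]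
    exact hy.2
  have hopen : IsOpenMap φ := by
    rw [isOpenMap_iff_nhds_le]
    intro x s hs
    rw [Filter.mem_map, Metric.mem_nhds_iff] at hs
    obtain ⟨η, hη, hs⟩ := hs
    obtain ⟨ε, hε, h1, h2⟩ := hloc x
    filter_upwards [Metric.ball_mem_nhds (φ x) (lt_min hε hη)] with q hq
    rw [Metric.mem_ball, lt_min_iff, dist_comm] at hq
    obtain ⟨y, hy, rfl⟩ := h2 q hq.1
    apply hs
    rw [Metric.mem_ball, dist_comm, ← h1 x y (by rw [dist_self]; exact hε) hy]
    exact hq.2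
  have hinj : Function.Injective φ := fun y z hyz => Subtype.ext
    (foldMap_injOn h hr hp (show dist p y < r by rw [dist_comm]; exact y.2)
      (show dist p z < r by rw [dist_comm]; exact z.2) (congrArg Subtype.val hyz))
  have hsurj : Function.Surjective φ := by
    intro q
    obtain ⟨z, hz, hzq⟩ := foldMap_surjOn h hr hp (q := q) (by rw [dist_comm]; exact q.2)
    exact ⟨⟨z, by rw [Metric.mem_ball, dist_comm]; exact hz⟩, Subtype.ext hzq⟩
  refine ⟨p, (Equiv.ofBijective φ ⟨hinj, hsurj⟩).toHomeomorphOfContinuousOpen hcont hopen,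
    fun x => ?_⟩
  obtain ⟨ε, hε, h1, -⟩ := hloc x
  refine ⟨Metric.ball x ε, Metric.ball_mem_nhds x hε, fun y hy z hz => h1 y z ?_ ?_⟩
  · rw [dist_comm]; exact hy
  · rw [dist_comm]; exact hz

end Disk

/-! ### Area as two-dimensional Hausdorff measure. -/

namespace UpperHalfPlane

/-- The Cartesian coordinates of a point of the upper half-plane. -/
def toProd (z : ℍ) : ℝ × ℝ := (z.re, z.im)

/-- The point of the upper half-plane with given Cartesian coordinates. -/
def ofProd (x : ℝ × ℝ) : ℍ := if h : 0 < x.2 then ⟨⟨x.1, x.2⟩, h⟩ else UpperHalfPlane.I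

theorem ofProd_toProd (z : ℍ) : ofProd z.toProd = z := by
  have h : 0 < z.toProd.2 := z.im_pos
  rw [ofProd, dif_pos h]
  rfl

theorem isOpenEmbedding_toProd : IsOpenEmbedding toProd :=
  Complex.equivRealProdCLM.toHomeomorph.isOpenEmbedding.comp isOpenEmbedding_coe

theorem dist_toProd_le (z w : ℍ) : dist z.toProd w.toProd ≤ dist (z : ℂ) w := by
  rw [Prod.dist_eq, Real.dist_eq, Real.dist_eq, Complex.dist_eq]
  exact max_le (Complex.abs_re_le_norm (z - w : ℂ)) (Complex.abs_im_le_norm (z - w : ℂ))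

theorem dist_coe_le_toProd (z w : ℍ) : dist (z : ℂ) w ≤ 2 * dist z.toProd w.toProd := by
  rw [Prod.dist_eq, Real.dist_eq, Real.dist_eq, Complex.dist_eq]
  have h := Complex.norm_le_abs_re_add_abs_im (z - w : ℂ)
  have h1 := le_max_left |z.toProd.1 - w.toProd.1| |z.toProd.2 - w.toProd.2|
  have h2 := le_max_right |z.toProd.1 - w.toProd.1| |z.toProd.2 - w.toProd.2|
  have e1 : |(z - w : ℂ).re| = |z.toProd.1 - w.toProd.1| := rfl
  have e2 : |(z - w : ℂ).im| = |z.toProd.2 - w.toProd.2| := rfl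
  rw [e1, e2] at h
  linarith

/-- On a ball the imaginary part is bounded away from zero, so the Cartesian chart has a Lipschitz
inverse there. Only finiteness, positivity and null sets of area are needed, so comparison with
Lebesgue measure up to constants suffices. -/
theorem exists_hausdorffMeasure_le (p : ℍ) (r : ℝ) : ∃ K : ℝ≥0∞, K ≠ ∞ ∧
    ∀ S ⊆ Metric.ball p r, μH[2] S ≤ K * volume (toProd '' S) := by
  set m := p.im * Real.exp (-r) with hm
  have hm0 : 0 < m := mul_pos p.im_pos (Real.exp_pos _)
  have him : ∀ z ∈ Metric.ball p r, m ≤ z.im := by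
    intro z hz
    have h1 := im_le_im_mul_exp_dist p z
    have h2 : Real.exp (dist p z) ≤ Real.exp r := Real.exp_le_exp.2 (by
      rw [dist_comm]; exact hz.le)
    rw [hm, Real.exp_neg, ← div_eq_mul_inv, div_le_iff₀ (Real.exp_pos _)]
    exact h1.trans (mul_le_mul_of_nonneg_left h2 z.im_pos.le)
  have hL : ∀ S ⊆ Metric.ball p r,
      LipschitzOnWith (Real.toNNReal (2 / m)) ofProd (toProd '' S) := by
    intro S hS
    apply LipschitzOnWith.of_dist_le_mul
    rintro _ ⟨z, hz, rfl⟩ _ ⟨w, hw, rfl⟩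
    rw [ofProd_toProd, ofProd_toProd, Real.coe_toNNReal _ (by positivity)]
    have h1 : m ≤ √(z.im * w.im) := by
      apply Real.le_sqrt_of_sq_le
      rw [sq]
      exact mul_le_mul (him z (hS hz)) (him w (hS hw)) hm0.le z.im_pos.le
    calc dist z w ≤ dist (z : ℂ) w / √(z.im * w.im) := dist_le_dist_coe_div_sqrt z w
      _ ≤ dist (z : ℂ) w / m := div_le_div_of_nonneg_left dist_nonneg hm0 h1
      _ ≤ 2 * dist z.toProd w.toProd / m :=
        div_le_div_of_nonneg_right (dist_coe_le_toProd z w) hm0.le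
      _ = 2 / m * dist z.toProd w.toProd := by ring
  refine ⟨(Real.toNNReal (2 / m) : ℝ≥0∞) ^ (2 : ℝ), by simp, fun S hS => ?_⟩
  have h := (hL S hS).hausdorffMeasure_image_le (d := 2) (by norm_num)
  rw [hausdorffMeasure_prod_real, image_image] at h
  simpa only [ofProd_toProd, image_id'] using h

theorem exists_le_hausdorffMeasure (p : ℍ) (r : ℝ) : ∃ K : ℝ≥0∞, K ≠ ∞ ∧
    ∀ S ⊆ Metric.ball p r, volume (toProd '' S) ≤ K * μH[2] S := by
  set m := p.im * Real.exp r * Real.exp (2 * r) with hm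
  have hm0 : 0 < m := mul_pos (mul_pos p.im_pos (Real.exp_pos _)) (Real.exp_pos _)
  have hL : ∀ S ⊆ Metric.ball p r, LipschitzOnWith (Real.toNNReal m) toProd S := by
    intro S hS
    apply LipschitzOnWith.of_dist_le_mul
    intro z hz w hw
    rw [Real.coe_toNNReal _ hm0.le]
    have hzr : dist z p < r := hS hz
    have hwr : dist w p < r := hS hw
    have hd : dist z w ≤ 2 * r := by linarith [dist_triangle_right z w p]
    have h1 : w.im ≤ p.im * Real.exp r :=
      (im_le_im_mul_exp_dist w p).trans
        (mul_le_mul_of_nonneg_left (Real.exp_le_exp.2 hwr.le) p.im_pos.le)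
    -- From `1 - d ≤ exp (-d)` follows `exp d - 1 ≤ d exp d`, and `d ≤ 2r` in the ball.
    have h2 : Real.exp (dist z w) - 1 ≤ Real.exp (2 * r) * dist z w := by
      have h3 := Real.add_one_le_exp (-dist z w)
      have h4 : Real.exp (dist z w) * Real.exp (-dist z w) = 1 := by
        rw [← Real.exp_add]; simp
      have h5 := Real.exp_pos (dist z w)
      have h6 : Real.exp (dist z w) * dist z w ≤ Real.exp (2 * r) * dist z w :=
        mul_le_mul_of_nonneg_right (Real.exp_le_exp.2 hd) dist_nonneg
      nlinarith
    have h3 : 0 ≤ Real.exp (dist z w) - 1 := by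
      linarith [Real.one_le_exp (dist_nonneg (x := z) (y := w))]
    calc dist z.toProd w.toProd ≤ dist (z : ℂ) w := dist_toProd_le z w
      _ ≤ w.im * (Real.exp (dist z w) - 1) := dist_coe_le z w
      _ ≤ (p.im * Real.exp r) * (Real.exp (2 * r) * dist z w) :=
        mul_le_mul h1 h2 h3 (mul_nonneg p.im_pos.le (Real.exp_pos _).le)
      _ = m * dist z w := by rw [hm]; ring
  refine ⟨(Real.toNNReal m : ℝ≥0∞) ^ (2 : ℝ), by simp, fun S hS => ?_⟩
  have h := (hL S hS).hausdorffMeasure_image_le (d := 2) (by norm_num)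
  rwa [hausdorffMeasure_prod_real] at h

theorem hausdorffMeasure_ball_lt_top (p : ℍ) (r : ℝ) : μH[2] (Metric.ball p r) < ∞ := by
  obtain ⟨K, hK, h⟩ := exists_hausdorffMeasure_le p r
  refine (h _ subset_rfl).trans_lt (ENNReal.mul_lt_top hK.lt_top ?_)
  refine (measure_mono (image_mono Metric.ball_subset_closedBall)).trans_lt ?_
  exact ((isCompact_closedBall p r).image isOpenEmbedding_toProd.continuous).measure_lt_top

theorem hausdorffMeasure_pos_of_isOpen {W : Set ℍ} (hW : IsOpen W) (hne : W.Nonempty) :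
    0 < μH[2] W := by
  obtain ⟨p, hp⟩ := hne
  obtain ⟨r, hr, hrW⟩ := Metric.isOpen_iff.1 hW p hp
  obtain ⟨K, hK, h⟩ := exists_le_hausdorffMeasure p r
  refine lt_of_lt_of_le ?_ (measure_mono hrW)
  have h1 : 0 < volume (toProd '' Metric.ball p r) :=
    (isOpenEmbedding_toProd.isOpenMap _ Metric.isOpen_ball).measure_pos _
      ((Metric.nonempty_ball.2 hr).image _)
  have h2 := h1.trans_le (h _ subset_rfl)
  rw [pos_iff_ne_zero] at h2 ⊢
  exact right_ne_zero_of_mul h2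

theorem volume_image_line (H : HypHalfPlane) : volume (toProd '' {z | H.height z = 0}) = 0 := by
  set S : Set (ℝ × ℝ) := {x | H.a * (x.1 ^ 2 + x.2 ^ 2) + H.b * x.1 + H.c = 0} with hS
  have hsub : toProd '' {z | H.height z = 0} ⊆ S := by
    rintro _ ⟨z, hz, rfl⟩
    exact (H.mem_line_iff z).2 hz
  refine measure_mono_null hsub ?_
  have hSm : MeasurableSet S := (isClosed_eq (by fun_prop) continuous_const).measurableSet
  -- By Fubini only vertical slices matter: all but one are empty if the line is vertical, and
  -- otherwise each has at most two points.
  rw [Measure.volume_eq_prod, Measure.measure_prod_null hSm]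
  have hn := H.normalized
  by_cases ha : H.a = 0
  · have hb : H.b ≠ 0 := by
      rintro hb
      rw [ha, hb] at hn
      norm_num at hn
    have hae : ∀ᵐ x : ℝ, x ≠ -H.c / H.b := by
      rw [ae_iff]
      simp
    filter_upwards [hae] with x hx
    have : Prod.mk x ⁻¹' S = ∅ := by
      ext y
      simp only [hS, ha, mem_preimage, mem_ofPred_eq, mem_empty_iff_false, iff_false]
      intro h
      apply hx
      rw [eq_div_iff hb]
      linarith
    simp [this]
  · refine Filter.Eventually.of_forall fun x => ?_
    set D := -(H.a * x ^ 2 + H.b * x + H.c) / H.a with hD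
    have hsub : Prod.mk x ⁻¹' S ⊆ {√D, -√D} := by
      intro y hy
      have hy' : H.a * (x ^ 2 + y ^ 2) + H.b * x + H.c = 0 := hy
      have hy2 : y ^ 2 = D := by
        rw [hD, eq_div_iff ha]
        linarith
      rw [← hy2, Real.sqrt_sq_eq_abs]
      rcases abs_choice y with h | h <;> simp [h]
    exact measure_mono_null hsub ((toFinite _).measure_zero _)

theorem hausdorffMeasure_line (H : HypHalfPlane) : μH[2] {z | H.height z = 0} = 0 := by
  have h : {z | H.height z = 0} ⊆
      ⋃ n : ℕ, {z | H.height z = 0} ∩ Metric.ball UpperHalfPlane.I n := by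
    intro z hz
    obtain ⟨n, hn⟩ := exists_nat_gt (dist z UpperHalfPlane.I)
    exact mem_iUnion.2 ⟨n, hz, hn⟩
  refine measure_mono_null h (measure_iUnion_null fun n => ?_)
  obtain ⟨K, hK, hle⟩ := exists_hausdorffMeasure_le UpperHalfPlane.I n
  have h0 : volume (toProd '' ({z | H.height z = 0} ∩ Metric.ball UpperHalfPlane.I n)) = 0 :=
    measure_mono_null (image_mono inter_subset_left) (volume_image_line H)
  have := hle _ (inter_subset_right (s := {z | H.height z = 0}))
  rw [h0, mul_zero] at this
  exact le_antisymm this zero_le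

end UpperHalfPlane

/-- A locally distance preserving homeomorphism preserves the Hausdorff measure. -/
theorem hausdorffMeasure_eq_of_locally_isometric {X Y : Type*} [MetricSpace X] [MetricSpace Y]
    [MeasurableSpace X] [BorelSpace X] [MeasurableSpace Y] [BorelSpace Y]
    [SecondCountableTopology X]
    {s : Set X} {t : Set Y} (ht : MeasurableSet t) (φ : s ≃ₜ t) {d : ℝ} (hd : 0 ≤ d)
    (h : ∀ x, ∃ U ∈ 𝓝 x, ∀ y ∈ U, ∀ z ∈ U, dist (φ y) (φ z) = dist y z) :
    μH[d] s = μH[d] t := by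
  set ψ : s → Y := fun x => (φ x : Y) with hψ
  have hme : MeasurableEmbedding ψ :=
    (MeasurableEmbedding.subtype_coe ht).comp φ.measurableEmbedding
  choose U hU hUd using h
  obtain ⟨C, hC, hCU⟩ := TopologicalSpace.countable_cover_nhds hU
  -- Two measures agree once their restrictions to a countable cover agree, and on each `U x` the
  -- map is an isometry.
  have heq : (μH[d] : Measure s) = (μH[d] : Measure Y).comap ψ := by
    rw [Measure.ext_iff_of_biUnion_eq_univ hC hCU]
    intro x hx
    ext A hA
    rw [Measure.restrict_apply hA, Measure.restrict_apply hA, hme.comap_apply]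
    have hiso : Isometry (fun y : (A ∩ U x : Set s) => ψ y) := Isometry.of_dist_eq fun y z =>
      hUd x y y.2.2 z z.2.2
    have h1 := hiso.hausdorffMeasure_image (Or.inl hd) univ
    have h2 := (isometry_subtype_coe (s := A ∩ U x)).hausdorffMeasure_image (Or.inl hd) univ
    rw [image_univ, Subtype.range_coe] at h2
    rw [h2, ← h1]
    congr 1
    ext y
    simp
  have h1 := (isometry_subtype_coe (s := s)).hausdorffMeasure_image (Or.inl hd) univ
  rw [image_univ, Subtype.range_coe] at h1
  rw [h1, heq, hme.comap_apply]
  congr 1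
  ext y
  simp only [image_univ, mem_range, hψ]
  constructor
  · rintro ⟨x, rfl⟩; exact (φ x).2
  · intro hy; exact ⟨φ.symm ⟨y, hy⟩, by simp⟩

/-- Moving `m` slightly towards the interior point `q` makes all heights positive. -/
theorem exists_interior_near {ι : Type*} {H : ι → HypHalfPlane} {q : ℍ}
    (hq : ∀ i, 0 < (H i).height q) {m : ℍ} (hm : m ∈ polygon H) {η : ℝ} (hη : 0 < η) :
    ∃ y, (∀ i, 0 < (H i).height y) ∧ dist y m < η := by
  set C := Real.cosh (dist q m) with hC
  have hC1 : 1 ≤ C := Real.one_le_cosh _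
  have hη1 : 1 < Real.cosh η := Real.one_lt_cosh.2 hη.ne'
  -- Makes `ε C` half of the gap `cosh η - 1`; the moved point has `cosh dist = (1 + ε C) / N` with
  -- `N ≥ 1`.
  set ε := (Real.cosh η - 1) / (2 * C) with hε
  have hε0 : 0 < ε := div_pos (by linarith) (by linarith)
  obtain ⟨u, N, hN, hN2, hH, hd⟩ := exists_combination m q (l := 1) (m := ε) one_pos.le hε0.le
    (by linarith)
  refine ⟨u, fun i => ?_, ?_⟩
  · rw [hH]
    have := mul_pos hε0 (hq i)
    have := hm i
    apply div_pos _ hN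
    linarith
  · have hN1 : 1 ≤ N := by
      rw [← one_le_sq_iff₀ hN.le, hN2]
      have := Real.one_le_cosh (dist m q)
      nlinarith
    have h1 : Real.cosh (dist u m) < Real.cosh η := by
      rw [hd, dist_self, Real.cosh_zero, ← hC, div_lt_iff₀ hN]
      have h2 : ε * C = (Real.cosh η - 1) / 2 := by
        rw [hε]; field_simp
      rw [h2]
      nlinarith
    rwa [Real.cosh_lt_cosh, abs_of_nonneg dist_nonneg, abs_of_pos hη] at h1

theorem HypHalfPlane.hausdorffMeasure_preimage_reflect (H : HypHalfPlane) (S : Set ℍ) :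
    μH[2] (H.reflect ⁻¹' S) = μH[2] S := by
  have hs : Function.Surjective H.reflect := fun z => ⟨_, H.reflect_reflect z⟩
  rw [H.isometry_reflect.hausdorffMeasure_preimage (Or.inr hs), hs.range_eq, inter_univ]

theorem hausdorffMeasure_ball_eq (o p : ℍ) (r : ℝ) :
    μH[2] (Metric.ball o r) = μH[2] (Metric.ball p r) := by
  obtain ⟨c, hc⟩ := MulAction.exists_smul_eq (Matrix.SpecialLinearGroup (Fin 2) ℝ) o p
  rw [← hc, ← (IsometryEquiv.constSMul c).hausdorffMeasure_image 2 (Metric.ball o r),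
    IsometryEquiv.image_ball]
  rfl

/-! ### The area obstruction. -/

section

variable {ι : Type*} {H : ι → HypHalfPlane}

theorem height_nonpos_of_reflect_mem {i : ι} {z : ℍ} (h : (H i).reflect z ∈ polygon H) :
    (H i).height z ≤ 0 := by
  have := h i
  rw [HypHalfPlane.height_reflect_self] at this
  linarith

/-- Without obtuse angles, the copy of the polygon reflected in side `i` stays on the inner side of
every other side. So copies reflected in different sides overlap at most along a line. -/
theorem height_nonneg_of_reflect_mem
    (hin : ∀ i j, i ≠ j → HypHalfPlane.normalInner (H i) (H j) ≤ 0) {i j : ι} (hij : i ≠ j)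
    {z : ℍ} (h : (H i).reflect z ∈ polygon H) : 0 ≤ (H j).height z := by
  have h1 := height_nonpos_of_reflect_mem h
  have h2 := h j
  rw [HypHalfPlane.height_reflect] at h2
  have := mul_nonneg_of_nonpos_of_nonpos (hin i j hij) h1
  linarith

/-- The midpoint of the two mirror images is in the polygon: adding the heights of the images over
side `i` cancels `± height p` and leaves `-2 normalInner` times a height, nonnegative as no angle is
obtuse. It marks the doubly covered region. -/
theorem exists_midpoint_mirrors
    (hin : ∀ i j, i ≠ j → HypHalfPlane.normalInner (H i) (H j) ≤ 0) {p : ℍ} (hp : p ∈ polygon H)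
    {i j : ι} (hij : i ≠ j) {r : ℝ}
    (hlt : dist ((H i).reflect p) ((H j).reflect p) < 2 * r) :
    ∃ m ∈ polygon H, dist ((H i).reflect p) m < r ∧ dist ((H j).reflect p) m < r := by
  set d := dist ((H i).reflect p) ((H j).reflect p) with hd0
  have hd : 0 ≤ d := dist_nonneg
  obtain ⟨m, N, hN, hN2, hH, hd⟩ := exists_combination ((H i).reflect p) ((H j).reflect p)
    (l := 1) (m := 1) one_pos.le one_pos.le (by norm_num)
  have hcos : Real.cosh d = 2 * Real.cosh (d / 2) ^ 2 - 1 := by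
    have := Real.cosh_two_mul (d / 2)
    rw [Real.sinh_sq, mul_div_cancel₀ _ two_ne_zero] at this
    linarith
  rw [← hd0, hcos] at hN2
  have hNc : N = 2 * Real.cosh (d / 2) := by
    rw [← sq_eq_sq₀ hN.le (by positivity), hN2]; ring
  have hc0 : 0 < Real.cosh (d / 2) := Real.cosh_pos _
  have key : ∀ x, Real.cosh (dist m x) = Real.cosh (d / 2) → dist x m < r := by
    intro x hx
    have := Real.cosh_injOn (dist_nonneg (x := m) (y := x)) (by simp only [mem_Ici]; linarith) hx
    rw [dist_comm, this]
    linarith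
  refine ⟨m, fun k => ?_, key _ ?_, key _ ?_⟩
  · rw [hH]
    apply div_nonneg _ hN.le
    rw [HypHalfPlane.height_reflect, HypHalfPlane.height_reflect]
    have aux : ∀ a b, a ≠ b → 0 ≤ -(HypHalfPlane.normalInner (H a) (H b) * (H a).height p) :=
      fun a b hab => neg_nonneg.2 (mul_nonpos_of_nonpos_of_nonneg (hin a b hab) (hp a))
    have hpk := hp k
    by_cases hki : i = k
    · subst hki
      have := aux j i hij.symm
      rw [HypHalfPlane.normalInner_self]
      linarith
    · by_cases hkj : j = k
      · subst hkj
        have := aux i j hij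
        rw [HypHalfPlane.normalInner_self]
        linarith
      · have := aux i k hki
        have := aux j k hkj
        linarith
  · rw [hd, dist_self, Real.cosh_zero, dist_comm ((H j).reflect p), ← hd0, hcos, hNc]
    field_simp
    ring
  · rw [hd, dist_self, Real.cosh_zero, ← hd0, hcos, hNc]
    field_simp
    ring

theorem isClosed_polygon : IsClosed (polygon H) := by
  have : polygon H = ⋂ i, {z | 0 ≤ (H i).height z} := by
    ext z; simp [polygon]
  rw [this]
  exact isClosed_iInter fun i => isClosed_le continuous_const (H i).continuous_height

theorem aedisjoint_of_subset_line {A B : Set ℍ} (K : HypHalfPlane)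
    (h : ∀ z ∈ A, z ∈ B → K.height z = 0) : AEDisjoint μH[2] A B :=
  measure_mono_null (fun z hz => h z hz.1 hz.2) (hausdorffMeasure_line K)

/-- An embedded disk of radius `r` about `p` in a double forces the mirror images of `p` to be
at distance at least `2 r`: otherwise the ball about `p` has too small an area. -/
theorem IsDouble.mirrorsSeparated [Finite ι] {X : Type*} [MetricSpace X] {f g : ℍ → X}
    (h : IsDouble H f g) (hin : ∀ i j, i ≠ j → HypHalfPlane.normalInner (H i) (H j) ≤ 0)
    {q : ℍ} (hq : ∀ i, 0 < (H i).height q) {p : ℍ} (hp : p ∈ polygon H) {r : ℝ}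
    (he : IsEmbeddedDisk (f p) r) : MirrorsSeparated H p r := by
  classical
  cases nonempty_fintype ι
  intro i j hij
  by_contra! hlt
  borelize X
  obtain ⟨o, φ, hφ⟩ := he
  have hμ : μH[2] (Metric.ball p r) = μH[2] (Metric.ball (f p) r) := by
    rw [← hausdorffMeasure_ball_eq o p r]
    exact hausdorffMeasure_eq_of_locally_isometric Metric.isOpen_ball.measurableSet φ
      (by norm_num) hφ
  set W : Set ℍ := {y | (∀ k, 0 < (H k).height y) ∧
    dist ((H i).reflect p) y < r ∧ dist ((H j).reflect p) y < r} with hW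
  have hWo : IsOpen W := by
    have : W = (⋂ k, {y | 0 < (H k).height y}) ∩ ({y | dist ((H i).reflect p) y < r} ∩
        {y | dist ((H j).reflect p) y < r}) := by
      ext y; simp [hW]
    rw [this]
    refine (isOpen_iInter_of_finite fun k =>
      isOpen_lt continuous_const (H k).continuous_height).inter (IsOpen.inter ?_ ?_)
    · exact isOpen_lt (by fun_prop) continuous_const
    · exact isOpen_lt (by fun_prop) continuous_const
  have hWne : W.Nonempty := by
    obtain ⟨m, hm, hmi, hmj⟩ := exists_midpoint_mirrors hin hp hij hlt
    obtain ⟨y, hy, hym⟩ := exists_interior_near hq hm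
      (η := min (r - dist ((H i).reflect p) m) (r - dist ((H j).reflect p) m))
      (lt_min (by linarith) (by linarith))
    rw [lt_min_iff, dist_comm] at hym
    have h1 := dist_triangle ((H i).reflect p) m y
    have h2 := dist_triangle ((H j).reflect p) m y
    exact ⟨y, hy, by linarith, by linarith⟩
  set E : ι → Set ℍ := fun k => {y | y ∈ polygon H ∧ dist ((H k).reflect p) y < r} with hE
  -- Points of `W` are reached across both sides `i` and `j`; dropping them from `E j` loses
  -- nothing, since `E i` still contains them.
  set E' : ι → Set ℍ := fun k => if k = j then E k \ W else E k with hE'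
  have hE'E : ∀ k, E' k ⊆ E k := by
    intro k
    simp only [hE']
    split_ifs
    · exact sdiff_subset
    · exact subset_rfl
  have hEm : ∀ k, MeasurableSet (E k) := fun k =>
    isClosed_polygon.measurableSet.inter
      (isOpen_lt (f := fun y => dist ((H k).reflect p) y) (by fun_prop)
        continuous_const).measurableSet
  have hE'm : ∀ k, MeasurableSet (E' k) := by
    intro k
    simp only [hE']
    split_ifs
    · exact (hEm k).diff hWo.measurableSet
    · exact hEm k
  have hcov : Metric.ball (f p) r ⊆ f '' (polygon H ∩ Metric.ball p r) ∪ g '' (⋃ k, E' k) := by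
    intro x hx
    rw [Metric.mem_ball, dist_comm] at hx
    rcases h.cover x with ⟨y, hy, rfl⟩ | ⟨y, hy, rfl⟩
    · rw [h.dist_left p hp y hy] at hx
      exact Or.inl ⟨y, ⟨hy, by rwa [Metric.mem_ball, dist_comm]⟩, rfl⟩
    · refine Or.inr ⟨y, ?_, rfl⟩
      obtain ⟨w, ⟨hw, k, hk⟩, hwd⟩ := h.exists_of_dist_lt p hp y hy _ hx
      have hyk : y ∈ E k := by
        refine ⟨hy, ?_⟩
        have := dist_triangle ((H k).reflect p) w y
        rw [HypHalfPlane.dist_reflect_comm _ p w, (H k).reflect_of_height_eq_zero hk] at this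
        linarith
      by_cases hyW : y ∈ W
      · refine mem_iUnion.2 ⟨i, ?_⟩
        simp only [hE', if_neg hij]
        exact ⟨hy, hyW.2.1⟩
      · refine mem_iUnion.2 ⟨k, ?_⟩
        simp only [hE']
        split_ifs
        · exact ⟨hyk, hyW⟩
        · exact hyk
  have hLf : LipschitzOnWith 1 f (polygon H ∩ Metric.ball p r) :=
    LipschitzOnWith.of_dist_le_mul fun x hx y hy => by
      rw [h.dist_left x hx.1 y hy.1]; simp
  have hLg : LipschitzOnWith 1 g (⋃ k, E' k) :=
    LipschitzOnWith.of_dist_le_mul fun x hx y hy => by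
      obtain ⟨k, hk⟩ := mem_iUnion.1 hx
      obtain ⟨l, hl⟩ := mem_iUnion.1 hy
      rw [h.dist_right x (hE'E k hk).1 y (hE'E l hl).1]; simp
  have hmeas : μH[2] (Metric.ball (f p) r) ≤
      μH[2] (polygon H ∩ Metric.ball p r) + ∑ k, μH[2] (E' k) := by
    refine (measure_mono hcov).trans ((measure_union_le _ _).trans (add_le_add ?_ ?_))
    · simpa using hLf.hausdorffMeasure_image_le (d := 2) (by norm_num)
    · refine le_trans ?_ (measure_iUnion_fintype_le _ _)
      simpa using hLg.hausdorffMeasure_image_le (d := 2) (by norm_num)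
  set P : Option ι → Set ℍ := fun a =>
    a.elim (polygon H ∩ Metric.ball p r) (fun k => (H k).reflect ⁻¹' (E' k)) with hP
  have hPm : ∀ a, MeasurableSet (P a) := by
    rintro (_ | k)
    · exact isClosed_polygon.measurableSet.inter Metric.isOpen_ball.measurableSet
    · exact (H k).isometry_reflect.continuous.measurable (hE'm k)
  have hPd : Pairwise (Function.onFun (AEDisjoint μH[2]) P) := by
    have hsome : ∀ k, AEDisjoint μH[2] (P none) (P (some k)) := fun k =>
      aedisjoint_of_subset_line (H k) fun z hz hz' =>
        le_antisymm (height_nonpos_of_reflect_mem (hE'E k hz').1) (hz.1 k)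
    rintro (_ | k) (_ | l) hkl
    · exact absurd rfl hkl
    · exact hsome l
    · exact (hsome k).symm
    · have hkl' : k ≠ l := fun he => hkl (by rw [he])
      exact aedisjoint_of_subset_line (H l) fun z hz hz' =>
        le_antisymm (height_nonpos_of_reflect_mem (hE'E l hz').1)
          (height_nonneg_of_reflect_mem hin hkl' (hE'E k hz).1)
  have hsum : μH[2] (⋃ a, P a) = μH[2] (polygon H ∩ Metric.ball p r) + ∑ k, μH[2] (E' k) := by
    rw [measure_iUnion₀ hPd fun a => (hPm a).nullMeasurableSet, tsum_fintype, Fintype.sum_option]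
    congr 1
    exact Finset.sum_congr rfl fun k _ => (H k).hausdorffMeasure_preimage_reflect _
  -- The dropped set, unfolded across side `j`, is an open part of the disk that misses all
  -- remaining pieces. These pieces already have at least the area of the ball in the double.
  set V : Set ℍ := (H j).reflect ⁻¹' W with hV
  have hVo : IsOpen V := hWo.preimage (H j).isometry_reflect.continuous
  have hVball : V ⊆ Metric.ball p r := by
    intro z hz
    rw [Metric.mem_ball, dist_comm, ← HypHalfPlane.dist_reflect_reflect (H j)]
    exact hz.2.2
  have hPV : Disjoint (⋃ a, P a) V := by
    rw [disjoint_iUnion_left]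
    intro a
    rw [disjoint_left]
    intro z hz hzV
    have hzj : (H j).height z < 0 := by
      have := hzV.1 j
      rw [HypHalfPlane.height_reflect_self] at this
      linarith
    rcases a with _ | k
    · exact absurd (hz.1 j) (by linarith)
    · by_cases hk : k = j
      · subst hk
        have hz' : (H k).reflect z ∈ E' k := hz
        simp only [hE', if_true] at hz'
        exact hz'.2 hzV
      · exact absurd (height_nonneg_of_reflect_mem hin hk (hE'E k hz).1) (by linarith)
  have hPball : (⋃ a, P a) ⊆ Metric.ball p r := by
    refine iUnion_subset ?_
    rintro (_ | k) z hz
    · exact hz.2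
    · rw [Metric.mem_ball, dist_comm, ← HypHalfPlane.dist_reflect_reflect (H k)]
      exact (hE'E k hz).2
  have h1 : μH[2] (⋃ a, P a) + μH[2] V ≤ μH[2] (Metric.ball p r) := by
    rw [← measure_union hPV hVo.measurableSet]
    exact measure_mono (union_subset hPball hVball)
  have h2 : μH[2] (Metric.ball p r) ≤ μH[2] (⋃ a, P a) := by
    rw [hsum, hμ]; exact hmeas
  have h3 : 0 < μH[2] V := by
    rw [hV, HypHalfPlane.hausdorffMeasure_preimage_reflect]
    exact hausdorffMeasure_pos_of_isOpen hWo hWne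
  have hfin : μH[2] (⋃ a, P a) ≠ ∞ :=
    ((measure_mono hPball).trans_lt (hausdorffMeasure_ball_lt_top p r)).ne
  exact absurd (h1.trans h2) (not_le.2 (ENNReal.lt_add_right hfin h3.ne'))

end

/-! ### Algebra of the loop condition. -/

/-- Minus the determinant of the Gram matrix of the unit normals of a triangle whose angles have
cosines `u, v, w`. -/
def gramDisc (u v w : ℝ) : ℝ := u ^ 2 + v ^ 2 + w ^ 2 + 2 * u * v * w - 1

/-- The quadratic form of the adjugate of the Gram matrix of the unit normals of a triangle whose
angles have cosines `u, v, w`. -/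
def gramForm (u v w a b c : ℝ) : ℝ :=
  (1 - u ^ 2) * a ^ 2 + (1 - v ^ 2) * b ^ 2 + (1 - w ^ 2) * c ^ 2
    + 2 * (w + u * v) * (a * b) + 2 * (u + v * w) * (b * c) + 2 * (v + w * u) * (c * a)

/-- A triangle whose angles have cosines `u, v, w` has a point at which the three geodesic loops
around the vertices have half-lengths whose squared hyperbolic sines are at least `σ`. -/
def AdmitsLoops (u v w σ : ℝ) : Prop :=
  ∃ a b c : ℝ, 0 ≤ a ∧ 0 ≤ b ∧ 0 ≤ c ∧ gramForm u v w a b c = gramDisc u v w ∧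
    σ ≤ b ^ 2 + c ^ 2 + 2 * u * (b * c) ∧ σ ≤ c ^ 2 + a ^ 2 + 2 * v * (c * a) ∧
    σ ≤ a ^ 2 + b ^ 2 + 2 * w * (a * b)

theorem gramDisc_rotate (u v w : ℝ) : gramDisc v w u = gramDisc u v w := by
  unfold gramDisc; ring

theorem AdmitsLoops.rotate {u v w σ : ℝ} (h : AdmitsLoops u v w σ) : AdmitsLoops v w u σ := by
  obtain ⟨a, b, c, ha, hb, hc, hQ, h1, h2, h3⟩ := h
  refine ⟨b, c, a, hb, hc, ha, ?_, h2, h3, h1⟩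
  rw [gramDisc_rotate, ← hQ]
  unfold gramForm
  ring

theorem gramDisc_mono {u v w u' v' w' : ℝ} (hu' : 0 ≤ u') (hv' : 0 ≤ v') (hw' : 0 ≤ w')
    (hu : u' ≤ u) (hv : v' ≤ v) (hw : w' ≤ w) : gramDisc u' v' w' ≤ gramDisc u v w := by
  unfold gramDisc
  have h0 : 0 ≤ u := hu'.trans hu
  have h1 : 0 ≤ v := hv'.trans hv
  gcongr

/-- Because `gramDisc = (w + uv)² - (1 - u²)(1 - v²)`, vanishing of `w + uv` would make it
nonpositive. -/
theorem offDiag_pos {u v w : ℝ} (hu : u ∈ Icc (0 : ℝ) 1) (hv : v ∈ Icc (0 : ℝ) 1)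
    (hw : w ∈ Icc (0 : ℝ) 1) (hD : 0 < gramDisc u v w) : 0 < w + u * v := by
  have h0 : 0 ≤ w + u * v := add_nonneg hw.1 (mul_nonneg hu.1 hv.1)
  refine lt_of_le_of_ne h0 fun h => ?_
  have h1 : gramDisc u v w = (w + u * v) ^ 2 - (1 - u ^ 2) * (1 - v ^ 2) := by
    unfold gramDisc; ring
  have h2 : 0 ≤ 1 - u ^ 2 := by nlinarith [hu.1, hu.2]
  have h3 : 0 ≤ 1 - v ^ 2 := by nlinarith [hv.1, hv.2]
  rw [h1, ← h] at hD
  nlinarith [mul_nonneg h2 h3]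

theorem gramForm_ge {u v w : ℝ} (hu : u ∈ Icc (0 : ℝ) 1) (hv : v ∈ Icc (0 : ℝ) 1)
    (hw : w ∈ Icc (0 : ℝ) 1) (hD : 0 < gramDisc u v w) :
    ∃ m > 0, ∀ a b c : ℝ, 0 ≤ a → 0 ≤ b → 0 ≤ c →
      m * (a * b + b * c + c * a) ≤ gramForm u v w a b c := by
  have h1 := offDiag_pos hu hv hw hD
  have h2 := offDiag_pos hv hw hu (by rwa [gramDisc_rotate])
  have h3 := offDiag_pos hw hu hv (by rwa [← gramDisc_rotate])
  refine ⟨min (w + u * v) (min (u + v * w) (v + w * u)), lt_min h1 (lt_min h2 h3), ?_⟩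
  set m := min (w + u * v) (min (u + v * w) (v + w * u))
  have m1 : m ≤ w + u * v := min_le_left _ _
  have m2 : m ≤ u + v * w := (min_le_right _ _).trans (min_le_left _ _)
  have m3 : m ≤ v + w * u := (min_le_right _ _).trans (min_le_right _ _)
  intro a b c ha hb hc
  have e1 : 0 ≤ (1 - u ^ 2) * a ^ 2 := mul_nonneg (by nlinarith [hu.1, hu.2]) (sq_nonneg _)
  have e2 : 0 ≤ (1 - v ^ 2) * b ^ 2 := mul_nonneg (by nlinarith [hv.1, hv.2]) (sq_nonneg _)
  have e3 : 0 ≤ (1 - w ^ 2) * c ^ 2 := mul_nonneg (by nlinarith [hw.1, hw.2]) (sq_nonneg _)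
  have ab := mul_nonneg ha hb
  have bc := mul_nonneg hb hc
  have ca := mul_nonneg hc ha
  have f1 := mul_le_mul_of_nonneg_right m1 ab
  have f2 := mul_le_mul_of_nonneg_right m2 bc
  have f3 := mul_le_mul_of_nonneg_right m3 ca
  have g1 := mul_nonneg h1.le ab
  have g2 := mul_nonneg h2.le bc
  have g3 := mul_nonneg h3.le ca
  unfold gramForm
  linarith

/-- Use the loop over the two smallest heights `x, y ≤ z`: it is at most `x² + y² + 2xy`, and `x² ≤
xz`, `y² ≤ yz`. With `gramForm_ge` this bounds `σ` and makes `gramForm` positive. It covers ideal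
vertices, where squares drop out of `gramForm`. -/
theorem le_four_mul_of_loops {u v w a b c σ : ℝ} (hu : u ≤ 1) (hv : v ≤ 1) (hw : w ≤ 1)
    (ha : 0 ≤ a) (hb : 0 ≤ b) (hc : 0 ≤ c)
    (h1 : σ ≤ b ^ 2 + c ^ 2 + 2 * u * (b * c)) (h2 : σ ≤ c ^ 2 + a ^ 2 + 2 * v * (c * a))
    (h3 : σ ≤ a ^ 2 + b ^ 2 + 2 * w * (a * b)) : σ ≤ 4 * (a * b + b * c + c * a) := by
  have aux : ∀ u x y z : ℝ, u ≤ 1 → 0 ≤ x → 0 ≤ y → x ≤ z → y ≤ z →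
      σ ≤ x ^ 2 + y ^ 2 + 2 * u * (x * y) → σ ≤ 4 * (x * y + y * z + z * x) := by
    intro u x y z hu hx hy hxz hyz h
    have e1 := mul_le_mul_of_nonneg_right hu (mul_nonneg hx hy)
    have e2 := mul_le_mul_of_nonneg_left hxz hx
    have e3 := mul_le_mul_of_nonneg_left hyz hy
    have e4 := mul_nonneg hx hy
    have e5 := mul_nonneg hx (hx.trans hxz)
    have e6 := mul_nonneg hy (hx.trans hxz)
    nlinarith
  rcases le_total a b with x | x <;> rcases le_total b c with y | y
  · linarith [aux w a b c hw ha hb (x.trans y) y h3]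
  · linarith [aux v c a b hv hc ha y x h2]
  · rcases le_total a c with z | z
    · linarith [aux w a b c hw ha hb z y h3]
    · linarith [aux u b c a hu hb hc x z h1]
  · linarith [aux u b c a hu hb hc x (y.trans x) h1]

theorem AdmitsLoops.bounded {u v w : ℝ} (hu : u ∈ Icc (0 : ℝ) 1) (hv : v ∈ Icc (0 : ℝ) 1)
    (hw : w ∈ Icc (0 : ℝ) 1) (hD : 0 < gramDisc u v w) :
    ∃ B, ∀ σ, AdmitsLoops u v w σ → σ ≤ B := by
  obtain ⟨m, hm, hmQ⟩ := gramForm_ge hu hv hw hD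
  refine ⟨4 * (gramDisc u v w / m), ?_⟩
  rintro σ ⟨a, b, c, ha, hb, hc, hQ, h1, h2, h3⟩
  have h4 := le_four_mul_of_loops hu.2 hv.2 hw.2 ha hb hc h1 h2 h3
  have h5 := hmQ a b c ha hb hc
  rw [hQ, ← le_div_iff₀' hm] at h5
  linarith

theorem AdmitsLoops.exists_pos {u v w : ℝ} (hu : u ∈ Icc (0 : ℝ) 1) (hv : v ∈ Icc (0 : ℝ) 1)
    (hw : w ∈ Icc (0 : ℝ) 1) (hD : 0 < gramDisc u v w) :
    ∃ t > 0, gramForm u v w t t t = gramDisc u v w ∧ AdmitsLoops u v w (t ^ 2) := by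
  obtain ⟨m, hm, hmQ⟩ := gramForm_ge hu hv hw hD
  have hq : 0 < gramForm u v w 1 1 1 := by
    have := hmQ 1 1 1 one_pos.le one_pos.le one_pos.le
    linarith
  set t := √(gramDisc u v w / gramForm u v w 1 1 1) with ht
  have ht0 : 0 < t := Real.sqrt_pos.2 (div_pos hD hq)
  have ht2 : t ^ 2 = gramDisc u v w / gramForm u v w 1 1 1 := Real.sq_sqrt (div_pos hD hq).le
  have hQ : gramForm u v w t t t = gramDisc u v w := by
    have : gramForm u v w t t t = t ^ 2 * gramForm u v w 1 1 1 := by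
      unfold gramForm; ring
    rw [this, ht2, div_mul_cancel₀ _ hq.ne']
  have h2 : 0 < t * t := mul_pos ht0 ht0
  refine ⟨t, ht0, hQ, t, t, t, ht0.le, ht0.le, ht0.le, hQ, ?_, ?_, ?_⟩
  · nlinarith [mul_nonneg hu.1 h2.le]
  · nlinarith [mul_nonneg hv.1 h2.le]
  · nlinarith [mul_nonneg hw.1 h2.le]

/-- A lower bound for half of the derivative of `gramDisc - gramForm` in its first argument. -/
theorem le_derivative {u v w a b c σ : ℝ} (hu : 0 ≤ u) (hv : v ∈ Icc (0 : ℝ) 1)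
    (hw : w ∈ Icc (0 : ℝ) 1) (hD : 0 < gramDisc u v w)
    (hQ : gramForm u v w a b c = gramDisc u v w) (hσ : 0 ≤ σ)
    (h2 : σ ≤ c ^ 2 + a ^ 2 + 2 * v * (c * a)) (h3 : σ ≤ a ^ 2 + b ^ 2 + 2 * w * (a * b)) :
    σ ≤ u + v * w + (u * a ^ 2 - v * (a * b) - w * (c * a) - b * c) := by
  have hv1 : 0 ≤ 1 - v ^ 2 := by nlinarith [hv.1, hv.2]
  have hw1 : 0 ≤ 1 - w ^ 2 := by nlinarith [hw.1, hw.2]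
  set K := u * a ^ 2 - v * (a * b) - w * (c * a) - b * c with hK
  set P := c ^ 2 + a ^ 2 + 2 * v * (c * a) with hP
  set R := a ^ 2 + b ^ 2 + 2 * w * (a * b) with hR
  have hid : ∀ x, (u + v * w + x * K) ^ 2 = (1 - v ^ 2 + x * P) * (1 - w ^ 2 + x * R)
      + (1 + x * a ^ 2) * (gramDisc u v w - x * gramForm u v w a b c) := by
    intro x
    rw [hK, hP, hR]
    unfold gramDisc gramForm
    ring
  have hE0 : 0 ≤ u + v * w := add_nonneg hu (mul_nonneg hv.1 hw.1)
  have hP0 : 0 ≤ P := hσ.trans h2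
  have hR0 : 0 ≤ R := hσ.trans h3
  -- The identity at `x = 1` only gives the square of the derivative. For `0 ≤ x < 1` its right side
  -- is positive, so `u + vw + xK`, nonnegative at `x = 0`, has no zero on the way and cannot end up
  -- negative.
  have hEnn : 0 ≤ u + v * w + K := by
    by_contra! hE
    have hK0 : K < 0 := by linarith
    set x := (u + v * w) / (-K) with hx
    have hx0 : 0 ≤ x := div_nonneg hE0 (by linarith)
    have hx1 : x < 1 := by rw [hx, div_lt_one (by linarith)]; linarith
    have hxK : u + v * w + x * K = 0 := by
      have : x * -K = u + v * w := div_mul_cancel₀ _ (by linarith)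
      linarith
    have h := hid x
    rw [hxK, hQ] at h
    have f1 : 0 ≤ (1 - v ^ 2 + x * P) * (1 - w ^ 2 + x * R) := by positivity
    have f2 : 0 < (1 + x * a ^ 2) * (gramDisc u v w - x * gramDisc u v w) := by
      have : 0 < gramDisc u v w - x * gramDisc u v w := by nlinarith
      positivity
    linarith
  have h := hid 1
  rw [hQ] at h
  have h4 : σ * σ ≤ (1 - v ^ 2 + 1 * P) * (1 - w ^ 2 + 1 * R) :=
    mul_le_mul (by linarith) (by linarith) hσ (by linarith)
  apply le_of_sq_le_sq _ hEnn
  nlinarith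

/-- Keep the heights while the cosine grows, then rescale them by `√(D / Q) ≥ 1` to satisfy the new
Gram equation. The factor depends on `σ₀` but not on `σ`, as needed for strictness of suprema. -/
theorem AdmitsLoops.step {u u' v w σ₀ : ℝ} (hu' : 0 ≤ u') (huu : u' ≤ u) (hu : u ≤ 1)
    (hv : v ∈ Icc (0 : ℝ) 1) (hw : w ∈ Icc (0 : ℝ) 1) (hD' : 0 < gramDisc u' v w) (hσ₀ : 0 < σ₀) :
    ∃ κ ≥ 1, (u' < u → 1 < κ) ∧ ∀ σ ≥ σ₀, AdmitsLoops u' v w σ → AdmitsLoops u v w (κ * σ) := by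
  have hD : 0 < gramDisc u v w := hD'.trans_le (gramDisc_mono hu' hv.1 hw.1 huu le_rfl le_rfl)
  have hδ : 0 ≤ u - u' := by linarith
  have hx0 : 0 ≤ 2 * σ₀ * (u - u') := by positivity
  refine ⟨1 + 2 * σ₀ * (u - u') / gramDisc u v w, ?_, ?_, ?_⟩
  · have : 0 ≤ 2 * σ₀ * (u - u') / gramDisc u v w := by positivity
    linarith
  · intro h
    have h1 : 0 < u - u' := by linarith
    have : 0 < 2 * σ₀ * (u - u') / gramDisc u v w := by positivity
    linarith
  rintro σ hσ ⟨a, b, c, ha, hb, hc, hQ, h1, h2, h3⟩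
  have hσ0 : 0 < σ := hσ₀.trans_le hσ
  have hE := le_derivative hu' hv hw hD' hQ hσ0.le h2 h3
  set E := u' + v * w + (u' * a ^ 2 - v * (a * b) - w * (c * a) - b * c) with hE0
  have hQD : gramForm u v w a b c ≤ gramDisc u v w - 2 * σ₀ * (u - u') := by
    -- The expansion in `u - u'` is exact; the quadratic coefficient `1 + a²` is positive and can be
    -- dropped.
    have e : gramDisc u v w - gramForm u v w a b c = gramDisc u' v w - gramForm u' v w a b c
        + 2 * E * (u - u') + (1 + a ^ 2) * (u - u') ^ 2 := by
      rw [hE0]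
      unfold gramDisc gramForm
      ring
    have e1 : 0 ≤ (1 + a ^ 2) * (u - u') ^ 2 := by positivity
    have e2 : σ₀ * (u - u') ≤ E * (u - u') := mul_le_mul_of_nonneg_right (hσ.trans hE) hδ
    rw [hQ] at e
    linarith
  have hQ0 : 0 < gramForm u v w a b c := by
    obtain ⟨m, hm, hmQ⟩ := gramForm_ge ⟨hu'.trans huu, hu⟩ hv hw hD
    have h4 := le_four_mul_of_loops (huu.trans hu) hv.2 hw.2 ha hb hc h1 h2 h3
    refine lt_of_lt_of_le ?_ (hmQ a b c ha hb hc)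
    have : 0 < a * b + b * c + c * a := by linarith
    positivity
  set Q := gramForm u v w a b c with hQdef
  set D := gramDisc u v w with hDdef
  have hκ : 1 + 2 * σ₀ * (u - u') / D ≤ D / Q := by
    rw [le_div_iff₀ hQ0]
    have e : (1 + 2 * σ₀ * (u - u') / D) * D = D + 2 * σ₀ * (u - u') := by
      field_simp
    have e2 : (1 + 2 * σ₀ * (u - u') / D) * Q
        ≤ (1 + 2 * σ₀ * (u - u') / D) * (D - 2 * σ₀ * (u - u')) :=
      mul_le_mul_of_nonneg_left hQD (by positivity)
    refine e2.trans ?_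
    have e3 : (1 + 2 * σ₀ * (u - u') / D) * (D - 2 * σ₀ * (u - u'))
        = D - (2 * σ₀ * (u - u')) ^ 2 / D := by
      field_simp; ring
    rw [e3]
    have : 0 ≤ (2 * σ₀ * (u - u')) ^ 2 / D := by positivity
    linarith
  set t := √(D / Q) with ht
  have ht2 : t ^ 2 = D / Q := Real.sq_sqrt (div_pos hD hQ0).le
  have ht0 : 0 ≤ t := Real.sqrt_nonneg _
  have hfin : ∀ L, σ ≤ L → (1 + 2 * σ₀ * (u - u') / D) * σ ≤ t ^ 2 * L := by
    intro L hL
    rw [ht2]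
    exact mul_le_mul hκ hL hσ0.le (div_pos hD hQ0).le
  refine ⟨t * a, t * b, t * c, mul_nonneg ht0 ha, mul_nonneg ht0 hb, mul_nonneg ht0 hc, ?_, ?_,
    ?_, ?_⟩
  · have : gramForm u v w (t * a) (t * b) (t * c) = t ^ 2 * Q := by
      rw [hQdef]; unfold gramForm; ring
    rw [this, ht2, div_mul_cancel₀ _ hQ0.ne']
  · refine (hfin (b ^ 2 + c ^ 2 + 2 * u * (b * c)) (h1.trans ?_)).trans (le_of_eq (by ring))
    have := mul_nonneg hb hc
    gcongr
  · exact (hfin _ h2).trans (le_of_eq (by ring))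
  · exact (hfin _ h3).trans (le_of_eq (by ring))

/-- The cosines are changed one at a time by cyclic symmetry; each factor is at least `1`, so the
bound `σ₀` stays valid for the next step. -/
theorem AdmitsLoops.mono {u v w u' v' w' σ₀ : ℝ} (hu' : 0 ≤ u') (hv' : 0 ≤ v') (hw' : 0 ≤ w')
    (huu : u' ≤ u) (hvv : v' ≤ v) (hww : w' ≤ w) (hu : u ≤ 1) (hv : v ≤ 1) (hw : w ≤ 1)
    (hD' : 0 < gramDisc u' v' w') (hσ₀ : 0 < σ₀) :
    ∃ κ ≥ 1, (u' < u ∨ v' < v ∨ w' < w → 1 < κ) ∧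
      ∀ σ ≥ σ₀, AdmitsLoops u' v' w' σ → AdmitsLoops u v w (κ * σ) := by
  have hD1 : 0 < gramDisc u v' w' := hD'.trans_le (gramDisc_mono hu' hv' hw' huu le_rfl le_rfl)
  have hD2 : 0 < gramDisc u v w' :=
    hD1.trans_le (gramDisc_mono (hu'.trans huu) hv' hw' le_rfl hvv le_rfl)
  obtain ⟨κ₁, hκ₁, hs₁, h₁⟩ := AdmitsLoops.step hu' huu hu ⟨hv', hvv.trans hv⟩
    ⟨hw', hww.trans hw⟩ hD' hσ₀
  obtain ⟨κ₂, hκ₂, hs₂, h₂⟩ := AdmitsLoops.step (v := w') (w := u) hv' hvv hv ⟨hw', hww.trans hw⟩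
    ⟨hu'.trans huu, hu⟩ (by rwa [gramDisc_rotate]) hσ₀
  obtain ⟨κ₃, hκ₃, hs₃, h₃⟩ := AdmitsLoops.step (v := u) (w := v) hw' hww hw
    ⟨hu'.trans huu, hu⟩ ⟨hv'.trans hvv, hv⟩ (by rwa [← gramDisc_rotate]) hσ₀
  have h12 : 1 ≤ κ₂ * κ₁ := one_le_mul_of_one_le_of_one_le hκ₂ hκ₁
  refine ⟨κ₃ * (κ₂ * κ₁), one_le_mul_of_one_le_of_one_le hκ₃ h12, ?_, fun σ hσ h => ?_⟩
  · rintro (h | h | h)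
    · have := hs₁ h
      nlinarith
    · have := hs₂ h
      nlinarith
    · have := hs₃ h
      nlinarith
  · have hσ0 : 0 ≤ σ := hσ₀.le.trans hσ
    have a1 : σ₀ ≤ κ₁ * σ := by nlinarith
    have a2 : σ₀ ≤ κ₂ * (κ₁ * σ) := by nlinarith
    have e : κ₃ * (κ₂ * κ₁) * σ = κ₃ * (κ₂ * (κ₁ * σ)) := by ring
    rw [e]
    exact (h₃ _ a2 (h₂ _ a1 (h₁ σ hσ h).rotate).rotate).rotate

theorem AdmitsLoops.anti {u v w σ τ : ℝ} (h : AdmitsLoops u v w σ) (hτ : τ ≤ σ) :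
    AdmitsLoops u v w τ := by
  obtain ⟨a, b, c, ha, hb, hc, hQ, h1, h2, h3⟩ := h
  exact ⟨a, b, c, ha, hb, hc, hQ, hτ.trans h1, hτ.trans h2, hτ.trans h3⟩

theorem gramDisc_cos_pos {α β γ : ℝ} (hα : α ∈ Icc 0 (Real.pi / 2)) (hβ : β ∈ Icc 0 (Real.pi / 2))
    (hγ : γ ∈ Icc 0 (Real.pi / 2)) (h : α + β + γ < Real.pi) :
    0 < gramDisc (Real.cos α) (Real.cos β) (Real.cos γ) := by
  have sα : 0 ≤ Real.sin α := Real.sin_nonneg_of_nonneg_of_le_pi hα.1 (by linarith [hα.2, hα.1])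
  have sβ : 0 ≤ Real.sin β := Real.sin_nonneg_of_nonneg_of_le_pi hβ.1 (by linarith [hβ.2, hβ.1])
  have key : Real.sin α * Real.sin β < Real.cos γ + Real.cos α * Real.cos β := by
    have := Real.cos_lt_cos_of_nonneg_of_le_pi hγ.1
      (by linarith [hα.1, hβ.1] : Real.pi - (α + β) ≤ Real.pi) (by linarith)
    rw [Real.cos_pi_sub, Real.cos_add] at this
    linarith
  have h1 := pow_lt_pow_left₀ key (mul_nonneg sα sβ) two_ne_zero
  rw [mul_pow, Real.sin_sq, Real.sin_sq] at h1
  unfold gramDisc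
  nlinarith

/-! ### Gram relations and points with prescribed heights. -/

open HypHalfPlane

/-- The Gram determinant of four vectors of Lorentz space vanishes. -/
theorem gram_relation (A B C : HypHalfPlane) (z : ℍ) :
    gramForm (-normalInner B C) (-normalInner C A) (-normalInner A B)
      (A.height z) (B.height z) (C.height z) =
    gramDisc (-normalInner B C) (-normalInner C A) (-normalInner A B) := by
  have hA := A.normalized
  have hB := B.normalized
  have hC := C.normalized
  have hz := z.coord_eq
  rw [height_eq_coord, height_eq_coord, height_eq_coord]
  -- Writing the norms `1` as variables homogenises the relation into an unconditional polynomial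
  -- identity.
  have hom : ∀ gA gB gC S : ℝ, gA = A.b ^ 2 - 4 * A.a * A.c → gB = B.b ^ 2 - 4 * B.a * B.c →
      gC = C.b ^ 2 - 4 * C.a * C.c → S = z.coordX * z.coordZ - z.coordY ^ 2 →
      (gB * gC - normalInner B C ^ 2) * (A.a * z.coordZ + A.b * z.coordY + A.c * z.coordX) ^ 2
      + (gC * gA - normalInner C A ^ 2) * (B.a * z.coordZ + B.b * z.coordY + B.c * z.coordX) ^ 2
      + (gA * gB - normalInner A B ^ 2) * (C.a * z.coordZ + C.b * z.coordY + C.c * z.coordX) ^ 2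
      + 2 * (normalInner B C * normalInner C A - normalInner A B * gC) *
        ((A.a * z.coordZ + A.b * z.coordY + A.c * z.coordX) *
        (B.a * z.coordZ + B.b * z.coordY + B.c * z.coordX))
      + 2 * (normalInner C A * normalInner A B - normalInner B C * gA) *
        ((B.a * z.coordZ + B.b * z.coordY + B.c * z.coordX) *
        (C.a * z.coordZ + C.b * z.coordY + C.c * z.coordX))
      + 2 * (normalInner A B * normalInner B C - normalInner C A * gB) *
        ((C.a * z.coordZ + C.b * z.coordY + C.c * z.coordX) *
        (A.a * z.coordZ + A.b * z.coordY + A.c * z.coordX)) =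
      S * (normalInner B C ^ 2 * gA + normalInner C A ^ 2 * gB + normalInner A B ^ 2 * gC
        - 2 * normalInner B C * normalInner C A * normalInner A B - gA * gB * gC) := by
    rintro _ _ _ _ rfl rfl rfl rfl
    unfold normalInner
    ring
  have h := hom 1 1 1 1 hA.symm hB.symm hC.symm hz.symm
  unfold gramForm gramDisc
  linear_combination h

/-- The solution of the linear system whose matrix is the Gram matrix of a triangle. -/
theorem exists_gram_solution {u v w : ℝ} (hu : u ∈ Icc (0 : ℝ) 1) (hv : v ∈ Icc (0 : ℝ) 1)
    (hw : w ∈ Icc (0 : ℝ) 1) (hD : 0 < gramDisc u v w) {a b c : ℝ} (ha : 0 ≤ a) (hb : 0 ≤ b)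
    (hc : 0 ≤ c) (hQ : gramForm u v w a b c = gramDisc u v w) :
    ∃ i j k : ℝ, i ≤ 0 ∧ j ≤ 0 ∧ k ≤ 0 ∧ i - w * j - v * k = a ∧ -w * i + j - u * k = b ∧
      -v * i - u * j + k = c ∧ i * a + j * b + k * c = -1 := by
  set D := gramDisc u v w with hDdef
  have hD' : u ^ 2 + v ^ 2 + w ^ 2 + 2 * u * v * w - 1 = D := rfl
  obtain ⟨hu0, hu1⟩ := hu
  obtain ⟨hv0, hv1⟩ := hv
  obtain ⟨hw0, hw1⟩ := hw
  have hu2 : 0 ≤ 1 - u ^ 2 := by nlinarith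
  have hv2 : 0 ≤ 1 - v ^ 2 := by nlinarith
  have hw2 : 0 ≤ 1 - w ^ 2 := by nlinarith
  refine ⟨-((1 - u ^ 2) * a + (w + u * v) * b + (v + w * u) * c) / D,
    -((w + u * v) * a + (1 - v ^ 2) * b + (u + v * w) * c) / D,
    -((v + w * u) * a + (u + v * w) * b + (1 - w ^ 2) * c) / D,
    div_nonpos_of_nonpos_of_nonneg (neg_nonpos.2 (by positivity)) hD.le,
    div_nonpos_of_nonpos_of_nonneg (neg_nonpos.2 (by positivity)) hD.le,
    div_nonpos_of_nonpos_of_nonneg (neg_nonpos.2 (by positivity)) hD.le, ?_, ?_, ?_, ?_⟩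
  · field_simp
    linear_combination a * hD'
  · field_simp
    linear_combination b * hD'
  · field_simp
    linear_combination c * hD'
  · unfold gramForm at hQ
    field_simp
    linear_combination -hQ

/-- A point with prescribed heights over the sides of a triangle. -/
theorem exists_heights (A B C : HypHalfPlane) {u v w : ℝ}
    (hBC : normalInner B C = -u) (hCA : normalInner C A = -v) (hAB : normalInner A B = -w)
    {z : ℍ} (hzA : 0 ≤ A.height z) (hzB : 0 ≤ B.height z) (hzC : 0 ≤ C.height z)
    {a b c i j k : ℝ} (hi0 : i ≤ 0) (hj0 : j ≤ 0) (hk0 : k ≤ 0)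
    (ea : i - w * j - v * k = a) (eb : -w * i + j - u * k = b) (ec : -v * i - u * j + k = c)
    (eQ : i * a + j * b + k * c = -1) :
    ∃ p : ℍ, A.height p = a ∧ B.height p = b ∧ C.height p = c := by
  have hA := A.normalized
  have hB := B.normalized
  have hC := C.normalized
  unfold normalInner at hBC hCA hAB
  set X := -2 * (i * A.a + j * B.a + k * C.a) with hX
  set Y := i * A.b + j * B.b + k * C.b with hY
  set Z := -2 * (i * A.c + j * B.c + k * C.c) with hZ
  have fA : A.a * Z + A.b * Y + A.c * X = a := by
    rw [← ea, hX, hY, hZ]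
    linear_combination i * hA + j * hAB + k * hCA
  have fB : B.a * Z + B.b * Y + B.c * X = b := by
    rw [← eb, hX, hY, hZ]
    linear_combination j * hB + i * hAB + k * hBC
  have fC : C.a * Z + C.b * Y + C.c * X = c := by
    rw [← ec, hX, hY, hZ]
    linear_combination k * hC + i * hCA + j * hBC
  have hXYZ : X * Z - Y ^ 2 = 1 := by
    have e : X * Z - Y ^ 2 = -(i * (A.a * Z + A.b * Y + A.c * X)
        + j * (B.a * Z + B.b * Y + B.c * X) + k * (C.a * Z + C.b * Y + C.c * X)) := by
      rw [hX, hY, hZ]; ring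
    rw [e, fA, fB, fC, eQ]; ring
  -- If `X < 0`, the negated vector is a point `q`, and `cosh (dist q z)` is a combination of the
  -- nonnegative heights of `z` with nonpositive coefficients, which is impossible.
  have hX0 : 0 < X := by
    by_contra! hneg
    have hXne : X ≠ 0 := by
      intro h0
      rw [h0, zero_mul, zero_sub] at hXYZ
      exact absurd hXYZ (ne_of_lt ((neg_nonpos.2 (sq_nonneg Y)).trans_lt one_pos))
    obtain ⟨q, q1, q2, q3⟩ := exists_coord (X := -X) (Y := -Y) (Z := -Z)
      (neg_pos.2 (lt_of_le_of_ne hneg hXne)) (by rw [neg_mul_neg, neg_sq, hXYZ])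
    have h1 := Real.cosh_pos (dist q z)
    have e : Real.cosh (dist q z) = i * A.height z + j * B.height z + k * C.height z := by
      rw [cosh_dist_eq_coord, height_eq_coord, height_eq_coord, height_eq_coord, q1, q2, q3,
        hX, hY, hZ]
      ring
    exact absurd e (ne_of_gt (lt_of_le_of_lt (add_nonpos (add_nonpos
      (mul_nonpos_of_nonpos_of_nonneg hi0 hzA) (mul_nonpos_of_nonpos_of_nonneg hj0 hzB))
      (mul_nonpos_of_nonpos_of_nonneg hk0 hzC)) h1))
  obtain ⟨p, p1, p2, p3⟩ := exists_coord hX0 hXYZ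
  exact ⟨p, by rw [height_eq_coord, p1, p2, p3, fA], by rw [height_eq_coord, p1, p2, p3, fB],
    by rw [height_eq_coord, p1, p2, p3, fC]⟩

theorem two_mul_le_dist_reflect_iff (H K : HypHalfPlane) {p : ℍ} {r : ℝ} (hr : 0 ≤ r) :
    2 * r ≤ dist (H.reflect p) (K.reflect p) ↔ Real.sinh r ^ 2 ≤ H.height p ^ 2 + K.height p ^ 2
      + 2 * -normalInner H K * (H.height p * K.height p) := by
  have h := cosh_dist_reflect_reflect H K p
  have h2 : Real.cosh (2 * r) = 1 + 2 * Real.sinh r ^ 2 := by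
    rw [Real.cosh_two_mul, Real.cosh_sq]; ring
  rw [← abs_of_nonneg (mul_nonneg zero_le_two hr),
    ← abs_of_nonneg (dist_nonneg (x := H.reflect p) (y := K.reflect p)), ← Real.cosh_le_cosh, h, h2]
  constructor <;> intro h3 <;> linarith

/-! ### From triangles to the loop condition. -/

namespace HypTriangle

variable {α β γ : ℝ}

/-- The half-planes that cut out the triangle. -/
def side (T : HypTriangle α β γ) : Fin 3 → HypHalfPlane := ![T.sideA, T.sideB, T.sideC]

theorem mem_polygon_iff (T : HypTriangle α β γ) {z : ℍ} : z ∈ polygon T.side ↔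
    0 ≤ T.sideA.height z ∧ 0 ≤ T.sideB.height z ∧ 0 ≤ T.sideC.height z := by
  simp [polygon, side, Fin.forall_fin_succ]

theorem carrier_eq (T : HypTriangle α β γ) : T.carrier = polygon T.side := by
  ext z
  rw [mem_polygon_iff, carrier, mem_inter_iff, mem_inter_iff, mem_carrier_iff, mem_carrier_iff,
    mem_carrier_iff, and_assoc]

theorem mem_boundary_iff (T : HypTriangle α β γ) (z : T.carrier) :
    z ∈ T.boundary ↔ (z : ℍ) ∈ polygonBoundary T.side := by
  have h : (z : ℍ) ∈ polygon T.side := by rw [← carrier_eq]; exact z.2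
  simp only [boundary, mem_ofPred_eq, mem_union, mem_line_iff, polygonBoundary, h, true_and]
  simp [side, Fin.exists_fin_succ, or_assoc]

theorem normalInner_side_nonpos (hα : α ∈ Icc 0 (Real.pi / 2)) (hβ : β ∈ Icc 0 (Real.pi / 2))
    (hγ : γ ∈ Icc 0 (Real.pi / 2)) (T : HypTriangle α β γ) (i j : Fin 3) (hij : i ≠ j) :
    normalInner (T.side i) (T.side j) ≤ 0 := by
  have hc : ∀ θ ∈ Icc 0 (Real.pi / 2), -Real.cos θ ≤ 0 := fun θ hθ =>
    neg_nonpos.2 (Real.cos_nonneg_of_mem_Icc ⟨by linarith [hθ.1, Real.pi_pos], hθ.2⟩)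
  have hA : normalInner T.sideB T.sideC ≤ 0 := T.angleA.trans_le (hc α hα)
  have hB : normalInner T.sideC T.sideA ≤ 0 := T.angleB.trans_le (hc β hβ)
  have hC : normalInner T.sideA T.sideB ≤ 0 := T.angleC.trans_le (hc γ hγ)
  have hA' := normalInner_comm T.sideC T.sideB ▸ hA
  have hB' := normalInner_comm T.sideA T.sideC ▸ hB
  have hC' := normalInner_comm T.sideB T.sideA ▸ hC
  fin_cases i <;> fin_cases j <;> first | exact absurd rfl hij | assumption

theorem mirrorsSeparated_iff (T : HypTriangle α β γ) {p : ℍ} {r : ℝ} (hr : 0 ≤ r) :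
    MirrorsSeparated T.side p r ↔
      Real.sinh r ^ 2 ≤ T.sideB.height p ^ 2 + T.sideC.height p ^ 2
        + 2 * Real.cos α * (T.sideB.height p * T.sideC.height p) ∧
      Real.sinh r ^ 2 ≤ T.sideC.height p ^ 2 + T.sideA.height p ^ 2
        + 2 * Real.cos β * (T.sideC.height p * T.sideA.height p) ∧
      Real.sinh r ^ 2 ≤ T.sideA.height p ^ 2 + T.sideB.height p ^ 2
        + 2 * Real.cos γ * (T.sideA.height p * T.sideB.height p) := by
  have eα : Real.cos α = -normalInner T.sideB T.sideC := by rw [T.angleA, neg_neg]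
  have eβ : Real.cos β = -normalInner T.sideC T.sideA := by rw [T.angleB, neg_neg]
  have eγ : Real.cos γ = -normalInner T.sideA T.sideB := by rw [T.angleC, neg_neg]
  rw [eα, eβ, eγ, ← two_mul_le_dist_reflect_iff _ _ hr, ← two_mul_le_dist_reflect_iff _ _ hr,
    ← two_mul_le_dist_reflect_iff _ _ hr]
  constructor
  · intro h
    exact ⟨h 1 2 (by decide), h 2 0 (by decide), h 0 1 (by decide)⟩
  · rintro ⟨hA, hB, hC⟩ i j hij
    have hA' := dist_comm (T.sideB.reflect p) (T.sideC.reflect p) ▸ hA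
    have hB' := dist_comm (T.sideC.reflect p) (T.sideA.reflect p) ▸ hB
    have hC' := dist_comm (T.sideA.reflect p) (T.sideB.reflect p) ▸ hC
    fin_cases i <;> fin_cases j <;> first | exact absurd rfl hij | assumption

theorem cos_mem_Icc {θ : ℝ} (hθ : θ ∈ Icc 0 (Real.pi / 2)) : Real.cos θ ∈ Icc (0 : ℝ) 1 :=
  ⟨Real.cos_nonneg_of_mem_Icc ⟨by linarith [hθ.1, Real.pi_pos], hθ.2⟩, Real.cos_le_one θ⟩

theorem exists_point (hα : α ∈ Icc 0 (Real.pi / 2)) (hβ : β ∈ Icc 0 (Real.pi / 2))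
    (hγ : γ ∈ Icc 0 (Real.pi / 2)) (hsum : α + β + γ < Real.pi) (T : HypTriangle α β γ)
    {a b c : ℝ} (ha : 0 ≤ a) (hb : 0 ≤ b) (hc : 0 ≤ c)
    (hQ : gramForm (Real.cos α) (Real.cos β) (Real.cos γ) a b c =
      gramDisc (Real.cos α) (Real.cos β) (Real.cos γ)) :
    ∃ p : ℍ, T.sideA.height p = a ∧ T.sideB.height p = b ∧ T.sideC.height p = c := by
  obtain ⟨z, hz⟩ := T.nonempty'
  have hz' := T.mem_polygon_iff.1 (T.carrier_eq ▸ hz : z ∈ polygon T.side)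
  obtain ⟨i, j, k, hi, hj, hk, e1, e2, e3, e4⟩ := exists_gram_solution (cos_mem_Icc hα)
    (cos_mem_Icc hβ) (cos_mem_Icc hγ) (gramDisc_cos_pos hα hβ hγ hsum) ha hb hc hQ
  exact exists_heights T.sideA T.sideB T.sideC T.angleA T.angleB T.angleC hz'.1 hz'.2.1 hz'.2.2
    hi hj hk e1 e2 e3 e4

theorem exists_mirrorsSeparated_iff (hα : α ∈ Icc 0 (Real.pi / 2))
    (hβ : β ∈ Icc 0 (Real.pi / 2)) (hγ : γ ∈ Icc 0 (Real.pi / 2)) (hsum : α + β + γ < Real.pi)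
    (T : HypTriangle α β γ) {r : ℝ} (hr : 0 ≤ r) :
    (∃ p ∈ polygon T.side, MirrorsSeparated T.side p r) ↔
      AdmitsLoops (Real.cos α) (Real.cos β) (Real.cos γ) (Real.sinh r ^ 2) := by
  constructor
  · rintro ⟨p, hp, h⟩
    obtain ⟨pA, pB, pC⟩ := T.mem_polygon_iff.1 hp
    refine ⟨_, _, _, pA, pB, pC, ?_, (T.mirrorsSeparated_iff hr).1 h⟩
    have := gram_relation T.sideA T.sideB T.sideC p
    rwa [T.angleA, T.angleB, T.angleC, neg_neg, neg_neg, neg_neg] at this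
  · rintro ⟨a, b, c, ha, hb, hc, hQ, h⟩
    obtain ⟨p, rfl, rfl, rfl⟩ := T.exists_point hα hβ hγ hsum ha hb hc hQ
    exact ⟨p, T.mem_polygon_iff.2 ⟨ha, hb, hc⟩, (T.mirrorsSeparated_iff hr).2 h⟩

theorem exists_interior (hα : α ∈ Icc 0 (Real.pi / 2))
    (hβ : β ∈ Icc 0 (Real.pi / 2)) (hγ : γ ∈ Icc 0 (Real.pi / 2)) (hsum : α + β + γ < Real.pi)
    (T : HypTriangle α β γ) : ∃ q, ∀ i, 0 < (T.side i).height q := by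
  obtain ⟨t, ht, hQ, -⟩ := AdmitsLoops.exists_pos (cos_mem_Icc hα) (cos_mem_Icc hβ)
    (cos_mem_Icc hγ) (gramDisc_cos_pos hα hβ hγ hsum)
  obtain ⟨p, hA, hB, hC⟩ := T.exists_point hα hβ hγ hsum ht.le ht.le ht.le hQ
  refine ⟨p, fun i => ?_⟩
  fin_cases i
  · exact ht.trans_eq hA.symm
  · exact ht.trans_eq hB.symm
  · exact ht.trans_eq hC.symm

theorem exists_isDouble (T : HypTriangle α β γ) :
    ∃ f g : ℍ → T.Surface, IsDouble T.side f g := by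
  classical
  obtain ⟨z₀, hz₀⟩ := T.nonempty'
  -- The value off the triangle is arbitrary: `IsDouble` only tests points of the polygon.
  let ext : ℍ → T.carrier := fun z => if h : z ∈ T.carrier then ⟨z, h⟩ else ⟨z₀, hz₀⟩
  have hext : ∀ z ∈ polygon T.side, (ext z : ℍ) = z := by
    intro z hz
    rw [← T.carrier_eq] at hz
    simp only [ext, dif_pos hz]
  have hext' : ∀ z : T.carrier, ext z = z := by
    intro z
    simp only [ext, dif_pos z.2]
  let f : T.carrier → T.Surface := Metric.toGlueL T.isometry_boundary T.isometry_boundary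
  let g : T.carrier → T.Surface := Metric.toGlueR T.isometry_boundary T.isometry_boundary
  refine ⟨fun z => f (ext z), fun z => g (ext z), ?_, ?_, ?_, ?_, ?_⟩
  · intro x hx y hy
    rw [(Metric.toGlueL_isometry T.isometry_boundary T.isometry_boundary).dist_eq,
      Subtype.dist_eq, hext x hx, hext y hy]
  · intro x hx y hy
    rw [(Metric.toGlueR_isometry T.isometry_boundary T.isometry_boundary).dist_eq,
      Subtype.dist_eq, hext x hx, hext y hy]
  · intro x hx
    have hb : ext x ∈ T.boundary := by rw [T.mem_boundary_iff, hext x hx.1]; exact hx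
    exact congrFun (Metric.toGlue_commute T.isometry_boundary T.isometry_boundary) ⟨ext x, hb⟩
  · intro x hx y hy r hr
    -- The final `0` is the additive parameter of the general gluing distance, which vanishes for
    -- exact gluing.
    have e : dist (f (ext x)) (g (ext y)) =
        (⨅ w : T.boundary, dist (ext x) w + dist (ext y) w) + 0 := rfl
    change dist (f (ext x)) (g (ext y)) < r at hr
    rw [e, add_zero] at hr
    obtain ⟨w, hw⟩ := exists_lt_of_ciInf_lt hr
    refine ⟨(w : T.carrier), (T.mem_boundary_iff _).1 w.2, ?_⟩
    rwa [Subtype.dist_eq, Subtype.dist_eq, hext x hx, hext y hy, dist_comm y] at hw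
  · intro q
    have hq : (∃ x, f x = q) ∨ ∃ x, g x = q := by
      induction q using Quotient.inductionOn with
      | h s =>
        rcases s with x | x
        · exact Or.inl ⟨x, rfl⟩
        · exact Or.inr ⟨x, rfl⟩
    rcases hq with ⟨x, rfl⟩ | ⟨x, rfl⟩
    · exact Or.inl ⟨x, T.carrier_eq ▸ x.2, by rw [hext']⟩
    · exact Or.inr ⟨x, T.carrier_eq ▸ x.2, by rw [hext']⟩

theorem maxInjRadius_eq (hα : α ∈ Icc 0 (Real.pi / 2))
    (hβ : β ∈ Icc 0 (Real.pi / 2)) (hγ : γ ∈ Icc 0 (Real.pi / 2)) (hsum : α + β + γ < Real.pi)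
    (T : HypTriangle α β γ) : maxInjRadius T.Surface =
      ⨆ (r : ℝ≥0) (_ : AdmitsLoops (Real.cos α) (Real.cos β) (Real.cos γ) (Real.sinh r ^ 2)),
        (r : ℝ≥0∞) := by
  obtain ⟨f, g, h⟩ := T.exists_isDouble
  obtain ⟨q, hq⟩ := T.exists_interior hα hβ hγ hsum
  have hin := T.normalInner_side_nonpos hα hβ hγ
  apply le_antisymm
  · refine iSup_le fun x => iSup₂_le fun r hr => ?_
    refine le_iSup₂_of_le r ?_ le_rfl
    rw [← T.exists_mirrorsSeparated_iff hα hβ hγ hsum (NNReal.coe_nonneg r)]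
    rcases h.cover x with ⟨p, hp, rfl⟩ | ⟨p, hp, rfl⟩
    · exact ⟨p, hp, h.mirrorsSeparated hin hq hp hr⟩
    · exact ⟨p, hp, h.symm.mirrorsSeparated hin hq hp hr⟩
  · refine iSup₂_le fun r hr => ?_
    rw [← T.exists_mirrorsSeparated_iff hα hβ hγ hsum (NNReal.coe_nonneg r)] at hr
    obtain ⟨p, hp, hr⟩ := hr
    exact le_iSup_of_le (f p) (le_iSup₂_of_le r (h.isEmbeddedDisk hr hp) le_rfl)

end HypTriangle

/-! ### Strict monotonicity of the supremum. -/

/-- The supremum of the radii of embedded disks that the loop condition allows. -/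
def loopRadius (u v w : ℝ) : ℝ≥0∞ :=
  ⨆ (r : ℝ≥0) (_ : AdmitsLoops u v w (Real.sinh r ^ 2)), (r : ℝ≥0∞)

theorem loopRadius_mono {u v w u' v' w' : ℝ} (hu' : 0 ≤ u') (hv' : 0 ≤ v') (hw' : 0 ≤ w')
    (huu : u' ≤ u) (hvv : v' ≤ v) (hww : w' ≤ w) (hu : u ≤ 1) (hv : v ≤ 1) (hw : w ≤ 1)
    (hD' : 0 < gramDisc u' v' w') : loopRadius u' v' w' ≤ loopRadius u v w := by
  refine iSup₂_le fun r hr => ?_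
  rcases eq_or_ne r 0 with rfl | hr0
  · simp
  have hs : 0 < Real.sinh r ^ 2 := pow_pos (Real.sinh_pos_iff.2 (by positivity)) 2
  obtain ⟨κ, hκ, -, h⟩ := AdmitsLoops.mono hu' hv' hw' huu hvv hww hu hv hw hD' hs
  exact le_iSup₂_of_le r ((h _ le_rfl hr).anti (by nlinarith)) le_rfl

theorem loopRadius_lt {u v w u' v' w' : ℝ} (hu' : 0 ≤ u') (hv' : 0 ≤ v') (hw' : 0 ≤ w')
    (huu : u' ≤ u) (hvv : v' ≤ v) (hww : w' ≤ w) (hu : u ≤ 1) (hv : v ≤ 1) (hw : w ≤ 1)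
    (hD' : 0 < gramDisc u' v' w') (hne : u' < u ∨ v' < v ∨ w' < w) :
    loopRadius u' v' w' < loopRadius u v w := by
  have iu : u' ∈ Icc (0 : ℝ) 1 := ⟨hu', huu.trans hu⟩
  have iv : v' ∈ Icc (0 : ℝ) 1 := ⟨hv', hvv.trans hv⟩
  have iw : w' ∈ Icc (0 : ℝ) 1 := ⟨hw', hww.trans hw⟩
  set S : Set ℝ := {r | 0 ≤ r ∧ AdmitsLoops u' v' w' (Real.sinh r ^ 2)} with hS
  obtain ⟨t, ht, -, htA⟩ := AdmitsLoops.exists_pos iu iv iw hD'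
  have ht' : Real.arsinh t ∈ S :=
    ⟨Real.arsinh_nonneg_iff.2 ht.le, by rwa [Real.sinh_arsinh]⟩
  obtain ⟨B, hB⟩ := AdmitsLoops.bounded iu iv iw hD'
  have hbdd : BddAbove S := by
    refine ⟨Real.arsinh √B, fun r hr => ?_⟩
    rw [← Real.sinh_le_sinh, Real.sinh_arsinh]
    exact Real.le_sqrt_of_sq_le (hB _ hr.2)
  set R := sSup S with hR
  have hR0 : 0 < R := (Real.arsinh_pos_iff.2 ht).trans_le (le_csSup hbdd ht')
  have hle : loopRadius u' v' w' ≤ ENNReal.ofReal R := by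
    refine iSup₂_le fun r hr => ?_
    rw [← ENNReal.ofReal_coe_nnreal]
    exact ENNReal.ofReal_le_ofReal (le_csSup hbdd ⟨r.2, hr⟩)
  obtain ⟨κ, -, hκ, h⟩ := AdmitsLoops.mono hu' hv' hw' huu hvv hww hu hv hw hD' (pow_pos ht 2)
  have hκ1 := hκ hne
  set s := √κ with hs
  have hs2 : s ^ 2 = κ := Real.sq_sqrt (by linarith)
  have hs1 : 1 < s := by rw [hs]; exact Real.lt_sqrt_of_sq_lt (by linarith)
  have hlt : Real.arsinh (Real.sinh R / s) < R := by
    rw [← Real.sinh_lt_sinh, Real.sinh_arsinh]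
    exact div_lt_self (Real.sinh_pos_iff.2 hR0) hs1
  obtain ⟨r, hr, hrlt⟩ := exists_lt_of_lt_csSup ⟨_, ht'⟩ hlt
  -- A radius so near the supremum that scaling its `sinh` by `s = √κ` passes `sinh R`, and large
  -- enough for the uniform factor, which needs `σ ≥ t²`.
  obtain ⟨r', hr', h1, h2⟩ : ∃ r' ∈ S, Real.arsinh (Real.sinh R / s) < r' ∧ Real.arsinh t ≤ r' := by
    rcases le_total r (Real.arsinh t) with h | h
    · exact ⟨_, ht', hrlt.trans_le h, le_rfl⟩
    · exact ⟨r, hr, hrlt, h⟩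
  rw [← Real.sinh_le_sinh, Real.sinh_arsinh] at h2
  rw [← Real.sinh_lt_sinh, Real.sinh_arsinh, div_lt_iff₀ (by linarith)] at h1
  have h3 := h _ (pow_le_pow_left₀ ht.le h2 2) hr'.2
  set ρ := Real.arsinh (Real.sinh r' * s) with hρ
  have hRρ : R < ρ := by rwa [← Real.sinh_lt_sinh, hρ, Real.sinh_arsinh]
  have hρ0 : 0 ≤ ρ := hR0.le.trans hRρ.le
  refine hle.trans_lt (lt_of_lt_of_le ((ENNReal.ofReal_lt_ofReal_iff (hR0.trans hRρ)).2 hRρ) ?_)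
  refine le_iSup₂_of_le (NNReal.mk ρ hρ0) ?_ (ENNReal.ofReal_eq_coe_nnreal hρ0).le
  change AdmitsLoops u v w (Real.sinh ρ ^ 2)
  rwa [hρ, Real.sinh_arsinh, mul_pow, hs2, mul_comm]

end

theorem mainTheorem11 (α β γ α' β' γ' : ℝ)
    (hα : α ∈ Set.Icc 0 (Real.pi / 2)) (hβ : β ∈ Set.Icc 0 (Real.pi / 2))
    (hγ : γ ∈ Set.Icc 0 (Real.pi / 2)) (hsum : α + β + γ < Real.pi)
    (hα' : α' ∈ Set.Icc 0 (Real.pi / 2)) (hβ' : β' ∈ Set.Icc 0 (Real.pi / 2))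
    (hγ' : γ' ∈ Set.Icc 0 (Real.pi / 2)) (hsum' : α' + β' + γ' < Real.pi)
    (hle : α ≤ α' ∧ β ≤ β' ∧ γ ≤ γ')
    (T : HypTriangle α β γ) (T' : HypTriangle α' β' γ') :
    maxInjRadius T'.Surface ≤ maxInjRadius T.Surface ∧
      (maxInjRadius T.Surface = maxInjRadius T'.Surface ↔ (α, β, γ) = (α', β', γ')) := by
  have hD' := gramDisc_cos_pos hα' hβ' hγ' hsum'
  have mono : ∀ {θ θ' : ℝ}, θ ∈ Icc 0 (Real.pi / 2) → θ' ∈ Icc 0 (Real.pi / 2) → θ ≤ θ' →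
      Real.cos θ' ≤ Real.cos θ := fun h h' hle =>
    Real.cos_le_cos_of_nonneg_of_le_pi h.1 (by linarith [h'.2, Real.pi_pos]) hle
  have smono : ∀ {θ θ' : ℝ}, θ ∈ Icc 0 (Real.pi / 2) → θ' ∈ Icc 0 (Real.pi / 2) → θ < θ' →
      Real.cos θ' < Real.cos θ := fun h h' hlt =>
    Real.cos_lt_cos_of_nonneg_of_le_pi h.1 (by linarith [h'.2, Real.pi_pos]) hlt
  have uα := HypTriangle.cos_mem_Icc hα'
  have uβ := HypTriangle.cos_mem_Icc hβ'
  have uγ := HypTriangle.cos_mem_Icc hγ'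
  have e : maxInjRadius T.Surface = loopRadius (Real.cos α) (Real.cos β) (Real.cos γ) :=
    T.maxInjRadius_eq hα hβ hγ hsum
  have e' : maxInjRadius T'.Surface = loopRadius (Real.cos α') (Real.cos β') (Real.cos γ') :=
    T'.maxInjRadius_eq hα' hβ' hγ' hsum'
  have hmono := loopRadius_mono uα.1 uβ.1 uγ.1 (mono hα hα' hle.1) (mono hβ hβ' hle.2.1)
    (mono hγ hγ' hle.2.2) (Real.cos_le_one _) (Real.cos_le_one _) (Real.cos_le_one _) hD'
  rw [e, e']
  refine ⟨hmono, fun heq => ?_, ?_⟩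
  · by_contra hne
    refine (loopRadius_lt uα.1 uβ.1 uγ.1 (mono hα hα' hle.1) (mono hβ hβ' hle.2.1)
      (mono hγ hγ' hle.2.2) (Real.cos_le_one _) (Real.cos_le_one _) (Real.cos_le_one _) hD'
      ?_).ne heq.symm
    by_contra! hcon
    apply hne
    have aux : ∀ {θ θ' : ℝ}, θ ∈ Icc 0 (Real.pi / 2) → θ' ∈ Icc 0 (Real.pi / 2) → θ ≤ θ' →
        Real.cos θ ≤ Real.cos θ' → θ = θ' := fun h h' hle hc =>
      hle.eq_of_not_lt fun hlt => absurd (smono h h' hlt) (not_lt.2 hc)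
    rw [aux hα hα' hle.1 hcon.1, aux hβ hβ' hle.2.1 hcon.2.1, aux hγ hγ' hle.2.2 hcon.2.2]
  · intro h
    simp only [Prod.mk.injEq] at h
    rw [h.1, h.2.1, h.2.2]
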